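/- A four-bar linkage in the plane is given by bar lengths $(l_1,l_2,l_3,L)\in\mathbb{R}^4_{>0}$ with $\max\{0,\,l_1-l_2-l_3,\,-l_1+l_2-l_3,\,-l_1-l_2+l_3\}<L<l_1+l_2+l_3$. A configuration is a quadruple of points $v_0,v_1,v_2,v_3\in\mathbb{R}^2$ with $v_0=(0,0)$, $v_3=(L,0)$ (the ends of the fixed bar), $|v_0v_1|=l_1$, $|v_1v_2|=l_2$, $|v_2v_3|=l_3$; bars may intersect. A pop of a vertex reflects it across the line through its two adjacent vertices in the cycle $v_0v_1v_2v_3$; if pops displace the fixed bar, the linkage is afterwards carried back by an orientation-preserving rigid motion so that this bar is at its place again. The neighbourhood of a configuration $\mathcal{C}'$ can be reached by pops alternating between two adjacent vertices $v,w$ if for every configuration $\mathcal{C}$ and every $\varepsilon>0$ there is an $n\in\mathbb{N}$ such that popping alternately $v$ and $w$, $n$ times each, starting from $\mathcal{C}$, leads to a configuration in which every vertex is at distance at most $\varepsilon$ from its position in $\mathcal{C}'$. Let $$T_1=-l_1+l_2-l_3+L,\qquad T_2=-l_1-l_2+l_3+L,\qquad T_3=-l_1+l_2+l_3-L.$$ **Corollary.**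 For almost all four-bar linkages (that is, all $(l_1,l_2,l_3,L)$ as above outside a set of Lebesgue measure zero) that satisfy $T_1T_2T_3<0$ and $$\max\{l_2,L\}\le\min\{l_1,l_3\}\quad\text{or}\quad\min\{l_2,L\}\ge\max\{l_1,l_3\},$$ there are two adjacent vertices $v,w$ such that the neighbourhood of every configuration that can be reached by smooth motion (through configurations of the linkage, from some configuration) can be reached by pops alternating between $v$ and $w$. -/

import Mathlib

open MeasureTheory
open scoped ContDiff

namespace FourBar

/-- A closed quadrilateral chain in the plane `ℂ`: the positions of its four vertices `0, 1, 2, 3`,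
in cyclic order. Bar `i` joins the vertices `i` and `i + 1` (modulo `4`). -/
abbrev Quad : Type := Fin 4 → ℂ

/-- The four positive bar lengths `l 0 = l₁`, `l 1 = l₂`, `l 2 = l₃`, `l 3 = L` (the last one is the
ground link) form a four-bar linkage:
`max {0, l₁ - l₂ - l₃, -l₁ + l₂ - l₃, -l₁ - l₂ + l₃} < L < l₁ + l₂ + l₃`. -/
structure IsLinkage (l : Fin 4 → ℝ) : Prop where
  pos : ∀ i, 0 < l i
  lower₁ : l 0 - l 1 - l 2 < l 3
  lower₂ : -l 0 + l 1 - l 2 < l 3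
  lower₃ : -l 0 - l 1 + l 2 < l 3
  upper : l 3 < l 0 + l 1 + l 2

/-- `T₁ = -l₁ + l₂ - l₃ + L`. -/
def T₁ (l : Fin 4 → ℝ) : ℝ := -l 0 + l 1 - l 2 + l 3

/-- `T₂ = -l₁ - l₂ + l₃ + L`. -/
def T₂ (l : Fin 4 → ℝ) : ℝ := -l 0 - l 1 + l 2 + l 3

/-- `T₃ = -l₁ + l₂ + l₃ - L`. -/
def T₃ (l : Fin 4 → ℝ) : ℝ := -l 0 + l 1 + l 2 - l 3

/-- `C` is a configuration of the linkage with bar lengths `l`: every bar has the right length (bars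
may intersect), and the ground link, which joins the vertices `3` and `0`, occupies its fixed
horizontal place: vertex `0` at the origin and vertex `3` at `(L, 0)`. -/
structure IsConfiguration (l : Fin 4 → ℝ) (C : Quad) : Prop where
  length_eq : ∀ i, dist (C i) (C (i + 1)) = l i
  ground_zero : C 0 = 0
  ground_three : C 3 = (l 3 : ℂ)

/-- `C'` can be reached from `C` by a smooth motion of the linkage. -/
def SmoothlyReachable (l : Fin 4 → ℝ) (C C' : Quad) : Prop :=
  ∃ γ : ℝ → Quad, ContDiffOn ℝ ∞ γ (Set.Icc 0 1) ∧
    (∀ t ∈ Set.Icc (0 : ℝ) 1, IsConfiguration l (γ t)) ∧ γ 0 = C ∧ γ 1 = C'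

/-- Popping the vertex `k`: it is reflected across the line through its two adjacent vertices, the
other three vertices stay. (If the two adjacent vertices coincide there is no such line and the
value has no meaning; this forces `T₁ T₂ T₃ = 0`.) -/
noncomputable def pop (k : Fin 4) (C : Quad) : Quad :=
  Function.update C k (EuclideanGeometry.reflection line[ℝ, C (k - 1), C (k + 1)] (C k))

/-- The orientation-preserving rigid motion `z ↦ a z + b` of the plane, applied to a chain. -/
noncomputable def move (a : Circle) (b : ℂ) (C : Quad) : Quad := fun i => (a : ℂ) * C i + b

/-- The neighborhood of `C'` can be reached by alternately popping the adjacent vertices `k` and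
`k + 1`: from every configuration `C` and for every `ε > 0`, some number of alternate pops leads to
a configuration each of whose vertices is at distance at most `ε` from its position in `C'`. If the
pops displace the ground link, the linkage is first carried by a rigid motion to the position in
which the ground link is at its fixed place again. -/
def CanReachNeighborhood (l : Fin 4 → ℝ) (k : Fin 4) (C' : Quad) : Prop :=
  ∀ C, IsConfiguration l C → ∀ ε : ℝ, 0 < ε →
    ∃ (n : ℕ) (a : Circle) (b : ℂ),
      IsConfiguration l (move a b ((pop (k + 1) ∘ pop k)^[n] C)) ∧
      ∀ i, dist (move a b ((pop (k + 1) ∘ pop k)^[n] C) i) (C' i) ≤ ε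

end FourBar

/-! With vertices 0 and 3 fixed, configurations are pairs `(v₁, v₂)` on a real algebraic curve. The
condition `T₁T₂T₃ < 0` excludes flat configurations and makes this curve connected
(`isPreconnected_curve`). On it there is a vector field (`field`) whose flow is reversed by the pop
of 1 and by the pop of 2: each pop carries integral curves to integral curves run backwards. The two
pops together therefore commute with the flow. A single integral curve covers everything
(`IsMotion.range_eq`) and is periodic (`IsMotion.exists_period`), so the double pop is a time shift
by some `d` on a circle of length `P`. If no positive multiple of `d` is an integer multiple of `P`,
its forward orbits are dense.

Otherwise some iterate of the double pop fixes every configuration. To exclude this for almost all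
bar lengths, let the quadrilateral itself vary: in the five real coordinates `(L, v₁, v₂)` the
iterates are rational, and near a flat quadrilateral their linearisation expands, so the `n`-th
iterate fixes only a null set (`volume_iterate_eq`). A quadrilateral with given orientations is
described by four bar lengths and one diagonal. Differentiable maps preserve null sets in equal
dimension, so Fubini yields, for almost all bar lengths, a diagonal whose quadrilateral never
returns (`ae_exists_iterate_ne`). -/

namespace FourBar

open Complex ComplexConjugate Topology Filter

/-! ### General tools: reflections, null sets, global flows, rotations of a circle. -/

/-- Reflection across the line through `p` and `q`. -/
theorem reflection_line {p q : ℂ} (h : p ≠ q) (z : ℂ) :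
    EuclideanGeometry.reflection line[ℝ, p, q] z = p + (q - p) * conj (z - p) / conj (q - p) := by
  have hqp : q - p ≠ 0 := sub_ne_zero.2 h.symm
  have hc : conj (q - p) ≠ 0 := (map_ne_zero _).2 hqp
  set r : ℝ := ((z - p) / (q - p)).re with hr
  have hproj : (EuclideanGeometry.orthogonalProjection line[ℝ, p, q] z : ℂ)
      = p + r • (q - p) := by
    rw [EuclideanGeometry.coe_orthogonalProjection_eq_iff_mem]
    constructor
    · have := AffineMap.lineMap_mem_affineSpan_pair (k := ℝ) r p q
      simpa [AffineMap.lineMap_apply, add_comm] using this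
    · rw [direction_affineSpan, vectorSpan_pair_rev, Submodule.mem_orthogonal_singleton_iff_inner_right]
      have : z -ᵥ (p + r • (q - p)) = (q - p) * (((z - p) / (q - p)).im * I) := by
        have h1 := re_add_im ((z - p) / (q - p))
        rw [eq_div_iff hqp] at h1
        simp only [vsub_eq_sub, real_smul]
        linear_combination -h1
      rw [this, vsub_eq_sub, Complex.inner]
      have : (q - p) * (((z - p) / (q - p)).im * I) * conj (q - p) =
        ((normSq (q - p) * ((z - p) / (q - p)).im : ℝ) : ℂ) * I := by
        push_cast
        rw [← mul_conj]; ring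
      rw [this]; simp
  rw [EuclideanGeometry.reflection_apply', hproj]
  have h2 : ((r : ℝ) : ℂ) = ((z - p) / (q - p) + conj ((z - p) / (q - p))) / 2 := by
    rw [add_conj]; simp [hr]
  simp only [vsub_eq_sub, vadd_eq_add, real_smul, h2]
  rw [map_div₀]
  field_simp
  ring

/-- The zero set of a nonzero polynomial is a null set. -/
theorem volume_zeros_eq_zero : ∀ (n : ℕ) (p : MvPolynomial (Fin n) ℂ), p ≠ 0 →
    volume {x : Fin n → ℝ | p.eval (fun i => (x i : ℂ)) = 0} = 0
  | 0, p, hp => by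
    have : {x : Fin 0 → ℝ | p.eval (fun i => (x i : ℂ)) = 0} = ∅ := by
      ext x
      simp only [Set.mem_ofPred_eq, Set.mem_empty_iff_false, iff_false]
      intro h
      apply hp
      rw [MvPolynomial.eq_C_of_isEmpty p] at h ⊢
      simp only [MvPolynomial.eval_C] at h
      simp [h]
    rw [this, measure_empty]
  | n + 1, p, hp => by
    have hmeas : ∀ (m : ℕ) (q : MvPolynomial (Fin m) ℂ),
        MeasurableSet {x : Fin m → ℝ | q.eval (fun i => (x i : ℂ)) = 0} := fun m q => by
      refine (isClosed_singleton.preimage ?_).measurableSet (s := _)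
      exact (MvPolynomial.continuous_eval q).comp (by fun_prop)
    have hmp := (volume_preserving_piFinSuccAbove (fun _ : Fin (n + 1) => ℝ) 0).symm
    rw [← hmp.measure_preimage (hmeas _ p).nullMeasurableSet]
    set f := MvPolynomial.finSuccEquiv ℂ n p with hf
    have hf0 : f ≠ 0 := by simpa [hf] using hp
    have hmeas2 : MeasurableSet ((MeasurableEquiv.piFinSuccAbove (fun _ : Fin (n + 1) => ℝ) 0).symm ⁻¹'
        {x | p.eval (fun i => (x i : ℂ)) = 0}) := MeasurableEquiv.measurable _ (hmeas _ p)
    rw [Measure.volume_eq_prod, Measure.prod_apply_symm hmeas2]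
    refine (lintegral_congr_ae ?_).trans lintegral_zero
    -- Fubini: off the null set where the leading coefficient vanishes, the slice is the root set of
    -- a nonzero polynomial in one variable, hence finite.
    have hlead := volume_zeros_eq_zero n f.leadingCoeff (by simpa using hf0)
    filter_upwards [measure_eq_zero_iff_ae_notMem.1 hlead] with y hy
    have hg : f.map (MvPolynomial.eval (fun i => (y i : ℂ))) ≠ 0 := fun h0 => hy (by
      have := congrArg (fun g => Polynomial.coeff g f.natDegree) h0
      simpa using this)
    have hfin : {z : ℂ | (f.map (MvPolynomial.eval (fun i => (y i : ℂ)))).IsRoot z}.Finite :=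
      Polynomial.finite_setOfPred_isRoot hg
    refine Set.Finite.measure_zero ?_ _
    refine (hfin.preimage ofReal_injective.injOn).subset ?_
    intro t ht
    simp only [Set.mem_preimage, Set.mem_ofPred_eq, Polynomial.IsRoot] at ht ⊢
    rw [← MvPolynomial.eval_eq_eval_mv_eval', ← ht]
    congr 2
    ext i
    refine Fin.cases ?_ (fun j => ?_) i <;> simp [MeasurableEquiv.piFinSuccAbove]

/-- Global existence for bounded Lipschitz vector fields. -/
theorem exists_global_solution {E : Type*} [NormedAddCommGroup E] [NormedSpace ℝ E]
    [CompleteSpace E] {v : E → E} {K B : NNReal} (hK : LipschitzWith K v) (hB : ∀ x, ‖v x‖ ≤ B)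
    (x : E) : ∃ γ : ℝ → E, γ 0 = x ∧ ∀ t, HasDerivAt γ (v (γ t)) t := by
  have hloc : ∀ n : ℕ, ∃ γ : ℝ → E, γ 0 = x ∧
      ∀ t ∈ Set.Ioo (-(n + 1 : ℝ)) (n + 1), HasDerivAt γ (v (γ t)) t := by
    intro n
    have h0 : (0 : ℝ) ∈ Set.Icc (-(n + 1 : ℝ)) (n + 1) := ⟨by linarith [n.cast_nonneg (α := ℝ)],
      by positivity⟩
    -- With speed at most `B`, the solution stays within `B * (n + 1)` of `x` during time `n + 1`,
    -- so the interval can be arbitrarily long.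
    have := IsPicardLindelof.of_time_independent (f := v) (t₀ := ⟨0, h0⟩) (x₀ := x)
      (a := B * (n + 1)) (r := 0) (L := B) (K := K) (fun x _ => hB x) hK.lipschitzOnWith
      (by simp)
    obtain ⟨γ, h1, h2⟩ := this.exists_eq_forall_mem_Icc_hasDerivWithinAt₀
    exact ⟨γ, h1, fun t ht => (h2 t (Set.Ioo_subset_Icc_self ht)).hasDerivAt (Icc_mem_nhds ht.1 ht.2)⟩
  choose γ h1 h2 using hloc
  have heq : ∀ m n : ℕ, m ≤ n → Set.EqOn (γ m) (γ n) (Set.Ioo (-(m + 1 : ℝ)) (m + 1)) := by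
    intro m n hmn
    have hmn' : (m : ℝ) ≤ n := by exact_mod_cast hmn
    refine ODE_solution_unique_of_mem_Ioo (v := fun _ => v) (s := fun _ => Set.univ) (t₀ := 0)
      (fun _ _ => hK.lipschitzOnWith) ⟨by linarith [m.cast_nonneg (α := ℝ)], by positivity⟩
      (fun t ht => ⟨h2 m t ht, trivial⟩) (fun t ht => ⟨h2 n t ⟨by linarith [ht.1], by linarith [ht.2]⟩,
        trivial⟩) (by rw [h1, h1])
  have hfl : ∀ t : ℝ, t ∈ Set.Ioo (-((⌊|t|⌋₊ : ℕ) + 1 : ℝ)) ((⌊|t|⌋₊ : ℕ) + 1) := fun t =>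
    abs_lt.1 (Nat.lt_floor_add_one |t|)
  refine ⟨fun t => γ ⌊|t|⌋₊ t, h1 _, fun t => ?_⟩
  have h3 := h2 _ t (hfl t)
  refine h3.congr_of_eventuallyEq ?_
  filter_upwards [Ioo_mem_nhds (hfl t).1 (hfl t).2] with s hs
  have : ⌊|s|⌋₊ ≤ ⌊|t|⌋₊ := Nat.lt_succ_iff.1 ((Nat.floor_lt (abs_nonneg _)).2 (by
    push_cast; exact abs_lt.2 hs))
  exact heq _ _ this (hfl s)

/-- Forward multiples of `d` come close to every real number modulo `P`, unless one of them is a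
multiple of `P`. -/
theorem exists_nsmul_near {P d : ℝ} (hP : 0 < P) (h : ∀ n : ℕ, 0 < n → ∀ m : ℤ, n * d ≠ m * P)
    (s δ : ℝ) (hδ : 0 < δ) : ∃ (n : ℕ) (m : ℤ), |n * d + m * P - s| < δ := by
  have hirr : Irrational (d / P) := by
    rintro ⟨q, hq⟩
    apply h q.den q.den_pos q.num
    rw [eq_div_iff hP.ne'] at hq
    have := Rat.cast_def (K := ℝ) q
    rw [this] at hq
    have hd : (q.den : ℝ) ≠ 0 := by exact_mod_cast q.den_ne_zero
    field_simp at hq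
    linarith
  have : Fact (0 < P) := ⟨hP⟩
  -- In the compact circle group, density of all multiples already gives density of the forward
  -- ones.
  have hd := denseRange_zsmul_iff_nsmul.1 (AddCircle.denseRange_zsmul_coe_iff.2 hirr)
  have hopen : IsOpen ((fun t : ℝ => (t : AddCircle P)) '' Metric.ball s δ) :=
    QuotientAddGroup.isOpenMap_coe _ Metric.isOpen_ball
  obtain ⟨n, t, ht, htn⟩ := hd.exists_mem_open hopen ⟨_, s, Metric.mem_ball_self hδ, rfl⟩
  have : ((t : ℝ) : AddCircle P) = ((n * d : ℝ) : AddCircle P) := by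
    rw [show (t : AddCircle P) = n • (d : AddCircle P) from htn]; simp
  rw [QuotientAddGroup.eq, AddSubgroup.mem_zmultiples_iff] at this
  obtain ⟨m, hm⟩ := this
  refine ⟨n, -m, ?_⟩
  rw [Metric.mem_ball, Real.dist_eq] at ht
  convert ht using 2
  simp only [zsmul_eq_mul] at hm
  push_cast
  linarith

/-! ### The configuration curve and the pops in complex coordinates. -/

/-- The positions of the vertices `1` and `2` in the configurations of the linkage. -/
def curve (l : Fin 4 → ℝ) : Set (ℂ × ℂ) :=
  {p | ‖p.1‖ = l 0 ∧ ‖p.1 - p.2‖ = l 1 ∧ ‖p.2 - (l 3 : ℂ)‖ = l 2}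

/-- The quadrilateral with ground link from `0` to `L` and the moving vertices given by `p`. -/
def toQuad (L : ℝ) (p : ℂ × ℂ) : Quad := ![0, p.1, p.2, (L : ℂ)]

theorem isConfiguration_toQuad {l : Fin 4 → ℝ} (h3 : 0 < l 3) {p : ℂ × ℂ} (hp : p ∈ curve l) :
    IsConfiguration l (toQuad (l 3) p) := by
  obtain ⟨h0, h1, h2⟩ := hp
  refine ⟨fun i => ?_, rfl, rfl⟩
  fin_cases i
  · simpa [toQuad] using h0
  · simpa [toQuad, dist_eq] using h1
  · simpa [toQuad, dist_eq] using h2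
  · simpa [toQuad] using h3.le

theorem IsConfiguration.exists_mem_curve {l : Fin 4 → ℝ} {C : Quad} (hC : IsConfiguration l C) :
    ∃ p ∈ curve l, C = toQuad (l 3) p := by
  refine ⟨(C 1, C 2), ⟨?_, ?_, ?_⟩, ?_⟩
  · simpa [hC.ground_zero] using hC.length_eq 0
  · simpa [dist_eq] using hC.length_eq 1
  · simpa [dist_eq, hC.ground_three] using hC.length_eq 2
  · ext i
    fin_cases i <;> simp [toQuad, hC.ground_zero, hC.ground_three]

/-- Popping the vertex `1`, in terms of the two moving vertices. -/
noncomputable def popOne (p : ℂ × ℂ) : ℂ × ℂ := (p.2 * conj p.1 / conj p.2, p.2)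

/-- Popping the vertex `2`, in terms of the two moving vertices. -/
noncomputable def popTwo (L : ℝ) (p : ℂ × ℂ) : ℂ × ℂ :=
  (p.1, L + (p.1 - L) * conj (p.2 - L) / conj (p.1 - L))

/-- Popping the vertex `1` and then the vertex `2`. -/
noncomputable def popBoth (L : ℝ) (p : ℂ × ℂ) : ℂ × ℂ := popTwo L (popOne p)

theorem pop_one_toQuad {L : ℝ} {p : ℂ × ℂ} (h : p.2 ≠ 0) :
    pop 1 (toQuad L p) = toQuad L (popOne p) := by
  have h2 : (toQuad L p) (1 - 1) ≠ (toQuad L p) (1 + 1) := by simpa [toQuad] using h.symm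
  rw [pop, reflection_line h2]
  ext i
  fin_cases i <;> simp [toQuad, popOne]

theorem pop_two_toQuad {L : ℝ} {p : ℂ × ℂ} (h : p.1 ≠ L) :
    pop 2 (toQuad L p) = toQuad L (popTwo L p) := by
  have h2 : (toQuad L p) (2 + 1) ≠ (toQuad L p) (2 - 1) := by simpa [toQuad] using h.symm
  rw [pop, EuclideanGeometry.eq_reflection_of_eq_subspace (s := line[ℝ, _, _])
    (congrArg (affineSpan ℝ) (Set.pair_comm _ _)), reflection_line h2]
  ext i
  fin_cases i <;> simp [toQuad, popTwo]

section Linkage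

variable {l : Fin 4 → ℝ}

theorem curve_re_im {p : ℂ × ℂ} (hp : p ∈ curve l) :
    p.1.re ^ 2 + p.1.im ^ 2 = l 0 ^ 2 ∧
    (p.1.re - p.2.re) ^ 2 + (p.1.im - p.2.im) ^ 2 = l 1 ^ 2 ∧
    (p.2.re - l 3) ^ 2 + p.2.im ^ 2 = l 2 ^ 2 := by
  obtain ⟨h0, h1, h2⟩ := hp
  rw [← h0, ← h1, ← h2, ← normSq_eq_norm_sq, ← normSq_eq_norm_sq, ← normSq_eq_norm_sq,
    normSq_apply, normSq_apply, normSq_apply]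
  simp only [sub_re, sub_im, ofReal_re, ofReal_im]
  exact ⟨by ring, by ring, by ring⟩

theorem fst_ne_zero (hl : IsLinkage l) {p : ℂ × ℂ} (hp : p ∈ curve l) : p.1 ≠ 0 :=
  norm_pos_iff.1 (hp.1 ▸ hl.pos 0)

theorem snd_ne_ground (hl : IsLinkage l) {p : ℂ × ℂ} (hp : p ∈ curve l) : p.2 ≠ (l 3 : ℂ) :=
  sub_ne_zero.1 (norm_pos_iff.1 (hp.2.2 ▸ hl.pos 2))

/-- If vertex 2 lay on vertex 0, the linkage would have `l₁ = l₂` and `l₃ = L`. This keeps the axis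
of the pop of 1 well defined. -/
theorem snd_ne_zero (hl : IsLinkage l) (hT : T₁ l * T₂ l * T₃ l < 0) {p : ℂ × ℂ}
    (hp : p ∈ curve l) : p.2 ≠ 0 := by
  intro h
  obtain ⟨h0, h1, h2⟩ := hp
  simp only [h, sub_zero, zero_sub, norm_neg, norm_real, Real.norm_eq_abs,
    abs_of_pos (hl.pos 3)] at h0 h1 h2
  have : T₁ l = 0 := by simp only [T₁]; linarith
  simp [this] at hT

/-- Here the coincidence of 1 and 3 forces `l₁ = L` and `l₂ = l₃`; the axis of the pop of 2 is thus
well defined. -/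
theorem fst_ne_ground (hl : IsLinkage l) (hT : T₁ l * T₂ l * T₃ l < 0) {p : ℂ × ℂ}
    (hp : p ∈ curve l) : p.1 ≠ (l 3 : ℂ) := by
  intro h
  obtain ⟨h0, h1, h2⟩ := hp
  rw [h] at h0 h1
  rw [norm_sub_rev] at h1
  simp only [norm_real, Real.norm_eq_abs, abs_of_pos (hl.pos 3)] at h0
  have : T₂ l = 0 := by simp only [T₂]; linarith
  simp [this] at hT

theorem norm_mul_conj_div {a b : ℂ} (ha : a ≠ 0) : ‖a * conj b / conj a‖ = ‖b‖ := by
  rw [norm_div, norm_mul, RCLike.norm_conj, RCLike.norm_conj, mul_div_cancel_left₀]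
  exact (norm_pos_iff.2 ha).ne'

theorem popOne_mem (hl : IsLinkage l) (hT : T₁ l * T₂ l * T₃ l < 0) {p : ℂ × ℂ}
    (hp : p ∈ curve l) : popOne p ∈ curve l := by
  have h := snd_ne_zero hl hT hp
  have hc : conj p.2 ≠ 0 := (map_ne_zero _).2 h
  refine ⟨(norm_mul_conj_div h).trans hp.1, ?_, hp.2.2⟩
  rw [← hp.2.1, popOne, ← norm_mul_conj_div h (b := p.1 - p.2)]
  congr 1
  rw [map_sub]
  field_simp

theorem popTwo_mem (hl : IsLinkage l) (hT : T₁ l * T₂ l * T₃ l < 0) {p : ℂ × ℂ}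
    (hp : p ∈ curve l) : popTwo (l 3) p ∈ curve l := by
  have h := sub_ne_zero.2 (fst_ne_ground hl hT hp)
  have hc : conj (p.1 - l 3) ≠ 0 := (map_ne_zero _).2 h
  refine ⟨hp.1, ?_, ?_⟩
  · rw [← hp.2.1, popTwo, ← norm_mul_conj_div h (b := p.1 - p.2)]
    congr 1
    rw [← sub_sub_sub_cancel_right p.1 p.2 (l 3 : ℂ), map_sub]
    field_simp
    simp only [map_sub]
    ring
  · rw [popTwo, add_sub_cancel_left, norm_mul_conj_div h, hp.2.2]

theorem popBoth_mem (hl : IsLinkage l) (hT : T₁ l * T₂ l * T₃ l < 0) {p : ℂ × ℂ}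
    (hp : p ∈ curve l) : popBoth (l 3) p ∈ curve l :=
  popTwo_mem hl hT (popOne_mem hl hT hp)

theorem iterate_pop_toQuad (hl : IsLinkage l) (hT : T₁ l * T₂ l * T₃ l < 0) (n : ℕ) {p : ℂ × ℂ}
    (hp : p ∈ curve l) : (popBoth (l 3))^[n] p ∈ curve l ∧
      (pop (1 + 1) ∘ pop 1)^[n] (toQuad (l 3) p) = toQuad (l 3) ((popBoth (l 3))^[n] p) := by
  induction n with
  | zero => exact ⟨hp, rfl⟩
  | succ n ih =>
    rw [Function.iterate_succ_apply', Function.iterate_succ_apply', ih.2]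
    refine ⟨popBoth_mem hl hT ih.1, ?_⟩
    rw [Function.comp_apply, pop_one_toQuad (snd_ne_zero hl hT ih.1), show (1 + 1 : Fin 4) = 2 from rfl,
      pop_two_toQuad (fst_ne_ground hl hT (popOne_mem hl hT ih.1))]
    rfl

end Linkage

/-! ### The vector field reversed by pops. -/

/-- The cross product of two plane vectors. -/
noncomputable def cross (a b : ℂ) : ℝ := (conj a * b).im

theorem cross_eq (a b : ℂ) : (cross a b : ℂ) = (conj a * b - a * conj b) / (2 * I) := by
  have h : conj a * b - a * conj b = conj a * b - conj (conj a * b) := by simp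
  rw [h, sub_conj, cross, eq_div_iff (by simp)]
  push_cast; ring

theorem cross_re_im (a b : ℂ) : cross a b = a.re * b.im - a.im * b.re := by
  simp [cross]; ring

/-- The vector field, tangent to all the curves of configurations with ground link `L`, that pops
reverse. -/
noncomputable def field (L : ℝ) (p : ℂ × ℂ) : ℂ × ℂ :=
  (I * p.1 * cross (p.1 - L) (p.2 - L), I * (p.2 - L) * cross p.1 p.2)

theorem hasDerivAt_conj {f : ℝ → ℂ} {f' : ℂ} {t : ℝ} (h : HasDerivAt f f' t) :
    HasDerivAt (fun s => conj (f s)) (conj f') t :=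
  conjCLE.hasFDerivAt.comp_hasDerivAt t h

/-- The pop of 2 keeps vertex 1 and changes the sign of the oriented area of the triangle 1, 2, 3.
Twice that area is the angular velocity of vertex 1, so the first component reverses. The second is
an algebraic identity. -/
theorem hasDerivAt_popTwo {L : ℝ} {γ : ℝ → ℂ × ℂ} {t : ℝ} (h : HasDerivAt γ (field L (γ t)) t)
    (h1 : (γ t).1 ≠ L) :
    HasDerivAt (fun s => popTwo L (γ s)) (-field L (popTwo L (γ t))) t := by
  have ha0 := sub_ne_zero.2 h1
  have hca0 : conj ((γ t).1 - L) ≠ 0 := (map_ne_zero _).2 ha0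
  have hf : HasDerivAt (fun s => (γ s).1) (field L (γ t)).1 t :=
    (ContinuousLinearMap.fst ℝ ℂ ℂ).hasFDerivAt.comp_hasDerivAt t h
  have hs : HasDerivAt (fun s => (γ s).2) (field L (γ t)).2 t :=
    (ContinuousLinearMap.snd ℝ ℂ ℂ).hasFDerivAt.comp_hasDerivAt t h
  have ha := hf.sub_const (L : ℂ)
  have hb := hs.sub_const (L : ℂ)
  have hw := ((ha.mul (hasDerivAt_conj hb)).div (hasDerivAt_conj ha) hca0).const_add (L : ℂ)
  refine (hf.prodMk hw).congr_deriv ?_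
  obtain ⟨a, ha'⟩ : ∃ a, a = (γ t).1 - L := ⟨_, rfl⟩
  obtain ⟨b, hb'⟩ : ∃ b, b = (γ t).2 - L := ⟨_, rfl⟩
  have e1 : (γ t).1 = a + L := by rw [ha']; ring
  have e2 : (γ t).2 = b + L := by rw [hb']; ring
  rw [← ha'] at hca0 ha0
  have hI := I_ne_zero
  ext1
  · simp only [field, popTwo, e1, e2, cross_eq, Prod.fst_neg, map_add, map_mul, map_div₀, conj_ofReal,
      conj_conj, add_sub_cancel_right, add_sub_cancel_left]
    field_simp
    ring
  · simp only [field, popTwo, e1, e2, cross_eq, Prod.snd_neg, map_add, map_sub, map_mul, map_div₀,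
      conj_ofReal, conj_conj, add_sub_cancel_right, add_sub_cancel_left, conj_I, map_ofNat, Pi.mul_apply]
    field_simp
    ring

theorem hasDerivAt_popOne {L : ℝ} {γ : ℝ → ℂ × ℂ} {t : ℝ} (h : HasDerivAt γ (field L (γ t)) t)
    (h2 : (γ t).2 ≠ 0) :
    HasDerivAt (fun s => popOne (γ s)) (-field L (popOne (γ t))) t := by
  have hca0 : conj (γ t).2 ≠ 0 := (map_ne_zero _).2 h2
  have hf : HasDerivAt (fun s => (γ s).1) (field L (γ t)).1 t :=
    (ContinuousLinearMap.fst ℝ ℂ ℂ).hasFDerivAt.comp_hasDerivAt t h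
  have hs : HasDerivAt (fun s => (γ s).2) (field L (γ t)).2 t :=
    (ContinuousLinearMap.snd ℝ ℂ ℂ).hasFDerivAt.comp_hasDerivAt t h
  have hw := (hs.mul (hasDerivAt_conj hf)).div (hasDerivAt_conj hs) hca0
  refine (hw.prodMk hs).congr_deriv ?_
  have hI := I_ne_zero
  ext1
  · simp only [field, popOne, cross_eq, Prod.fst_neg, map_sub, map_mul, map_div₀, conj_ofReal, conj_conj,
      conj_I, map_ofNat, Pi.mul_apply]
    field_simp
    ring
  · simp only [field, popOne, cross_eq, Prod.snd_neg, map_sub, map_mul, map_div₀, conj_ofReal, conj_conj]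
    field_simp
    ring

/-- An integral curve of `field (l 3)` that runs through configurations of the linkage `l`. -/
def IsMotion (l : Fin 4 → ℝ) (γ : ℝ → ℂ × ℂ) : Prop :=
  ∀ t, HasDerivAt γ (field (l 3) (γ t)) t ∧ γ t ∈ curve l

variable {l : Fin 4 → ℝ}

theorem contDiff_cross : ContDiff ℝ 1 (fun p : ℂ × ℂ => cross p.1 p.2) := by
  have h1 : ContDiff ℝ 1 (fun p : ℂ × ℂ => conj p.1 * p.2) :=
    (conjCLE.contDiff.comp contDiff_fst).mul contDiff_snd
  exact imCLM.contDiff.comp h1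

theorem contDiff_field (L : ℝ) : ContDiff ℝ 1 (field L) := by
  have h1 : ContDiff ℝ 1 (fun p : ℂ × ℂ => ((cross (p.1 - L) (p.2 - L) : ℝ) : ℂ)) :=
    ofRealCLM.contDiff.comp (contDiff_cross.comp
      ((contDiff_fst.sub contDiff_const).prodMk (contDiff_snd.sub contDiff_const)))
  have h2 : ContDiff ℝ 1 (fun p : ℂ × ℂ => ((cross p.1 p.2 : ℝ) : ℂ)) :=
    ofRealCLM.contDiff.comp contDiff_cross
  exact ((contDiff_const.mul contDiff_fst).mul h1).prodMk
    ((contDiff_const.mul (contDiff_snd.sub contDiff_const)).mul h2)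

theorem curve_subset_closedBall (l : Fin 4 → ℝ) :
    curve l ⊆ Metric.closedBall 0 (max (l 0) (l 2 + |l 3|)) := by
  rintro p ⟨h0, -, h2⟩
  rw [mem_closedBall_zero_iff, Prod.norm_def]
  refine max_le_max h0.le ?_
  calc ‖p.2‖ = ‖(p.2 - l 3) + l 3‖ := by rw [sub_add_cancel]
    _ ≤ _ := (norm_add_le _ _).trans (by rw [h2, norm_real, Real.norm_eq_abs])

/-- The field is only locally Lipschitz, but the curve lies in a compact ball, where one constant
serves for uniqueness. -/
theorem IsMotion.eq {γ δ : ℝ → ℂ × ℂ} (hγ : IsMotion l γ) (hδ : IsMotion l δ) {t : ℝ}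
    (h : γ t = δ t) : γ = δ := by
  obtain ⟨K, hK⟩ := ((contDiff_field (l 3)).contDiffOn (s :=
    Metric.closedBall 0 (max (l 0) (l 2 + |l 3|)))).exists_lipschitzOnWith one_ne_zero
    (convex_closedBall _ _) (isCompact_closedBall _ _)
  exact ODE_solution_unique_univ (v := fun _ => field (l 3)) (s := fun _ => curve l)
    (fun _ => hK.mono (curve_subset_closedBall l)) hγ hδ h

theorem IsMotion.shift {γ : ℝ → ℂ × ℂ} (hγ : IsMotion l γ) (s : ℝ) :
    IsMotion l (fun t => γ (t + s)) :=
  fun t => ⟨(hγ (t + s)).1.comp_add_const t s, (hγ (t + s)).2⟩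

theorem IsMotion.continuous {γ : ℝ → ℂ × ℂ} (hγ : IsMotion l γ) : Continuous γ :=
  continuous_iff_continuousAt.2 fun t => (hγ t).1.continuousAt

theorem IsMotion.popTwo_neg (hl : IsLinkage l) (hT : T₁ l * T₂ l * T₃ l < 0) {γ : ℝ → ℂ × ℂ}
    (hγ : IsMotion l γ) : IsMotion l (fun t => popTwo (l 3) (γ (-t))) := fun t => by
  refine ⟨?_, popTwo_mem hl hT (hγ _).2⟩
  have := (hasDerivAt_popTwo (hγ (-t)).1 (fst_ne_ground hl hT (hγ _).2)).scomp t (hasDerivAt_neg t)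
  simpa using! this

theorem IsMotion.popOne_neg (hl : IsLinkage l) (hT : T₁ l * T₂ l * T₃ l < 0) {γ : ℝ → ℂ × ℂ}
    (hγ : IsMotion l γ) : IsMotion l (fun t => popOne (γ (-t))) := fun t => by
  refine ⟨?_, popOne_mem hl hT (hγ _).2⟩
  have := (hasDerivAt_popOne (hγ (-t)).1 (snd_ne_zero hl hT (hγ _).2)).scomp t (hasDerivAt_neg t)
  simpa using! this

/-- The two time reversals cancel. -/
theorem IsMotion.popBoth (hl : IsLinkage l) (hT : T₁ l * T₂ l * T₃ l < 0) {γ : ℝ → ℂ × ℂ}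
    (hγ : IsMotion l γ) : IsMotion l (fun t => popBoth (l 3) (γ t)) := by
  simpa [FourBar.popBoth] using (hγ.popOne_neg hl hT).popTwo_neg hl hT

/-! ### Existence of motions for all times. -/

/-- The angular velocities of the bars `0` and `2`. -/
noncomputable def angularField (l : Fin 4 → ℝ) (x : ℝ × ℝ) : ℝ × ℝ :=
  (l 0 * l 2 * Real.sin (x.2 - x.1) - l 3 * l 2 * Real.sin x.2,
    -(l 0 * l 3 * Real.sin x.1) + l 0 * l 2 * Real.sin (x.2 - x.1))

/-- Written in the angles of the two moving end bars, the field becomes globally bounded and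
Lipschitz, which `field` itself is not. -/
theorem exists_lipschitz_angularField (l : Fin 4 → ℝ) :
    ∃ K B : NNReal, LipschitzWith K (angularField l) ∧ ∀ x, ‖angularField l x‖ ≤ B := by
  have hsin : LipschitzWith 1 Real.sin := Real.lipschitzWith_sin
  have h1 : LipschitzWith (1 * (1 + 1)) (fun x : ℝ × ℝ => Real.sin (x.2 - x.1)) :=
    hsin.comp (LipschitzWith.prod_snd.sub LipschitzWith.prod_fst)
  have h2 : LipschitzWith (1 * 1) (fun x : ℝ × ℝ => Real.sin x.2) :=
    hsin.comp LipschitzWith.prod_snd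
  have h3 : LipschitzWith (1 * 1) (fun x : ℝ × ℝ => Real.sin x.1) :=
    hsin.comp LipschitzWith.prod_fst
  have hm : ∀ c : ℝ, LipschitzWith ‖c‖₊ (fun y : ℝ => c * y) := fun c => lipschitzWith_smul c
  refine ⟨_, (|l 0 * l 2| + |l 3 * l 2| + |l 0 * l 3|).toNNReal,
    ((((hm (l 0 * l 2)).comp h1).sub ((hm (l 3 * l 2)).comp h2)).prodMk
      (((hm (l 0 * l 3)).comp h3).neg.add ((hm (l 0 * l 2)).comp h1))), fun x => ?_⟩
  rw [Real.coe_toNNReal _ (by positivity), angularField, Prod.norm_def]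
  have hb : ∀ c y : ℝ, |c * Real.sin y| ≤ |c| := fun c y => by
    rw [abs_mul]; exact mul_le_of_le_one_right (abs_nonneg _) (Real.abs_sin_le_one _)
  have b1 := hb (l 0 * l 2) (x.2 - x.1)
  have b2 := hb (l 3 * l 2) x.2
  have b3 := hb (l 0 * l 3) x.1
  refine max_le ?_ ?_
  · refine (abs_sub _ _).trans ?_
    linarith [abs_nonneg (l 0 * l 3)]
  · refine (abs_add_le _ _).trans ?_
    rw [abs_neg]
    linarith [abs_nonneg (l 3 * l 2)]

theorem exists_motion (hl : IsLinkage l) {p : ℂ × ℂ} (hp : p ∈ curve l) :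
    ∃ γ, IsMotion l γ ∧ γ 0 = p := by
  obtain ⟨K, B, hK, hB⟩ := exists_lipschitz_angularField l
  obtain ⟨x, hx0, hx⟩ := exists_global_solution hK hB (arg p.1, arg (p.2 - l 3))
  set γ : ℝ → ℂ × ℂ := fun t => (l 0 * exp ((x t).1 * I), l 3 + l 2 * exp ((x t).2 * I)) with hγ
  have hγ0 : γ 0 = p := by
    simp only [hγ, hx0]
    ext1
    · simp only
      rw [← hp.1, norm_mul_exp_arg_mul_I]
    · simp only
      rw [← hp.2.2, norm_mul_exp_arg_mul_I, add_sub_cancel]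
  have hre : ∀ y : ℝ, exp (y * I) = ⟨Real.cos y, Real.sin y⟩ := fun y => by
    rw [exp_mul_I]; apply Complex.ext <;> simp [← ofReal_cos, ← ofReal_sin]
  have hder : ∀ t, HasDerivAt γ (field (l 3) (γ t)) t := by
    intro t
    have h1 : HasDerivAt (fun s => (x s).1) (angularField l (x t)).1 t :=
      (ContinuousLinearMap.fst ℝ ℝ ℝ).hasFDerivAt.comp_hasDerivAt t (hx t)
    have h2 : HasDerivAt (fun s => (x s).2) (angularField l (x t)).2 t :=
      (ContinuousLinearMap.snd ℝ ℝ ℝ).hasFDerivAt.comp_hasDerivAt t (hx t)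
    have h3 := ((h1.ofReal_comp.mul_const I).cexp).const_mul (l 0 : ℂ)
    have h4 := (((h2.ofReal_comp.mul_const I).cexp).const_mul (l 2 : ℂ)).const_add (l 3 : ℂ)
    refine (h3.prodMk h4).congr_deriv ?_
    have c1 : cross ((γ t).1 - l 3) ((γ t).2 - l 3) = (angularField l (x t)).1 := by
      simp only [cross_re_im, hγ, hre, angularField, Real.sin_sub]
      simp
      ring
    have c2 : cross (γ t).1 (γ t).2 = (angularField l (x t)).2 := by
      simp only [cross_re_im, hγ, hre, angularField, Real.sin_sub]
      simp
      ring
    rw [field, c1, c2]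
    ext1
    · simp only [hγ]; ring
    · simp only [hγ]; ring
  -- The ansatz in angles fixes the lengths of bars 0 and 2; the length of bar 1 is conserved
  -- because the field is tangent.
  have hconst : ∀ t, normSq ((γ t).1 - (γ t).2) = normSq ((γ 0).1 - (γ 0).2) := by
    have hd : ∀ t, HasDerivAt (fun s => ((γ s).1 - (γ s).2) * conj ((γ s).1 - (γ s).2)) 0 t := by
      intro t
      have hf := (ContinuousLinearMap.fst ℝ ℂ ℂ).hasFDerivAt.comp_hasDerivAt t (hder t)
      have hs := (ContinuousLinearMap.snd ℝ ℂ ℂ).hasFDerivAt.comp_hasDerivAt t (hder t)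
      have h1 := (hf.sub hs).mul (hasDerivAt_conj (hf.sub hs))
      refine h1.congr_deriv ?_
      have hI := I_ne_zero
      simp only [field, cross_eq, map_sub, map_mul, map_div₀, conj_ofReal, conj_conj, conj_I,
        map_ofNat, ContinuousLinearMap.coe_fst', ContinuousLinearMap.coe_snd', Pi.sub_apply,
        Function.comp_apply]
      field_simp
      ring
    intro t
    have := is_const_of_deriv_eq_zero (fun t => (hd t).differentiableAt) (fun t => (hd t).deriv) t 0
    simp only [mul_conj] at this
    exact_mod_cast this
  refine ⟨γ, fun t => ⟨hder t, ?_, ?_, ?_⟩, hγ0⟩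
  · simp [hγ, norm_exp_ofReal_mul_I, abs_of_pos (hl.pos 0)]
  · have := hconst t
    rw [hγ0, normSq_eq_norm_sq, normSq_eq_norm_sq, hp.2.1] at this
    exact (sq_eq_sq₀ (norm_nonneg _) (hl.pos 1).le).1 this
  · simp [hγ, norm_exp_ofReal_mul_I, abs_of_pos (hl.pos 2)]

/-! ### A motion fills a neighbourhood of each of its points in the curve. -/

/-- A complex number is determined by its modulus, its imaginary part and the sign of its real part;
apply this to `conj a * b`. -/
theorem eq_of_cross_eq {a b c : ℂ} (ha : a ≠ 0) (h : cross a b = cross a c) (hn : ‖b‖ = ‖c‖)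
    (hb : 0 < (conj a * b).re) (hc : 0 < (conj a * c).re) : b = c := by
  have hca : conj a ≠ 0 := (map_ne_zero _).2 ha
  refine mul_left_cancel₀ hca (Complex.ext ?_ h)
  have h1 : normSq (conj a * b) = normSq (conj a * c) := by
    rw [normSq_mul, normSq_mul, normSq_eq_norm_sq b, normSq_eq_norm_sq c, hn]
  rw [normSq_apply, normSq_apply, show (conj a * b).im = (conj a * c).im from h] at h1
  exact (sq_eq_sq₀ hb.le hc.le).1 (by linarith)

/-- The side lengths of the triangle `0, a, b` determine the modulus and the real part of `conj a *
b`; the orientation picks the sign of the imaginary part. -/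
theorem eq_of_norm_eq {a b c : ℂ} (ha : a ≠ 0) (hn : ‖b‖ = ‖c‖) (hd : ‖a - b‖ = ‖a - c‖)
    (h : 0 < cross a b * cross a c) : b = c := by
  have hca : conj a ≠ 0 := (map_ne_zero _).2 ha
  have h1 : (conj a * b).re = (conj a * c).re := by
    have e1 : normSq (a - b) = normSq (a - c) := by
      rw [normSq_eq_norm_sq, normSq_eq_norm_sq, hd]
    have e2 : normSq b = normSq c := by
      rw [normSq_eq_norm_sq, normSq_eq_norm_sq, hn]
    simp only [normSq_apply, sub_re, sub_im] at e1 e2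
    simp
    linarith
  refine mul_left_cancel₀ hca (Complex.ext h1 ?_)
  have h2 : normSq (conj a * b) = normSq (conj a * c) := by
    rw [normSq_mul, normSq_mul, normSq_eq_norm_sq b, normSq_eq_norm_sq c, hn]
  rw [normSq_apply, normSq_apply, h1] at h2
  change cross a b = cross a c
  have h3 : (cross a b - cross a c) * (cross a b + cross a c) = 0 := by
    have : cross a b * cross a b = cross a c * cross a c := by
      simpa [cross] using h2
    linear_combination this
  rcases mul_eq_zero.1 h3 with h4 | h4
  · linarith
  · rw [eq_neg_of_add_eq_zero_left h4] at h
    nlinarith [mul_self_nonneg (cross a c)]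

/-- No configuration is flat. -/
theorem cross_ne_zero_or (hl : IsLinkage l) (hT : T₁ l * T₂ l * T₃ l < 0) {p : ℂ × ℂ}
    (hp : p ∈ curve l) : cross (p.1 - l 3) (p.2 - l 3) ≠ 0 ∨ cross p.1 p.2 ≠ 0 := by
  by_contra! hcon
  obtain ⟨hP, hQ⟩ := hcon
  obtain ⟨h0, h1, h2⟩ := curve_re_im hp
  rw [cross_re_im] at hP hQ
  simp only [sub_re, sub_im, ofReal_re, ofReal_im, sub_zero] at hP hQ
  have hpos := hl.pos
  have h3 : l 3 * (p.2.im - p.1.im) = 0 := by linear_combination hQ - hP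
  have h4 : p.2.im = p.1.im := by
    rcases mul_eq_zero.1 h3 with h | h
    · exact absurd h (hpos 3).ne'
    · linarith
  have h5 : p.1.im * (p.1.re - p.2.re) = 0 := by
    rw [h4] at hQ; linear_combination hQ
  have h6 : p.1.im = 0 := by
    rcases mul_eq_zero.1 h5 with h | h
    · exact h
    · rw [h4, h] at h1
      have := pow_pos (hpos 1) 2
      nlinarith
  rw [h4, h6] at h1 h2
  rw [h6] at h0
  simp only [ne_eq, OfNat.ofNat_ne_zero, not_false_eq_true, zero_pow, add_zero, sub_self] at h0 h1 h2
  have e1 := hl.lower₁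
  have e2 := hl.lower₂
  have e3 := hl.lower₃
  have e4 := hl.upper
  have t1 : T₁ l ≠ 0 := fun h => by simp [h] at hT
  have t2 : T₂ l ≠ 0 := fun h => by simp [h] at hT
  have t3 : T₃ l ≠ 0 := fun h => by simp [h] at hT
  simp only [T₁, T₂, T₃] at t1 t2 t3
  have p0 := hpos 0
  have p1 := hpos 1
  have p2 := hpos 2
  have p3 := hpos 3
  -- A flat configuration gives `L = ±l₁ ± l₂ ± l₃`. One minus sign makes some `Tᵢ` vanish; the
  -- other choices violate the linkage inequalities or positivity.
  rcases sq_eq_sq_iff_eq_or_eq_neg.1 h0 with g0 | g0 <;>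
  rcases sq_eq_sq_iff_eq_or_eq_neg.1 h1 with g1 | g1 <;>
  rcases sq_eq_sq_iff_eq_or_eq_neg.1 h2 with g2 | g2 <;>
  first
  | linarith
  | exact t1 (by linarith)
  | exact t2 (by linarith)
  | exact t3 (by linarith)

theorem IsMotion.hasStrictDerivAt {γ : ℝ → ℂ × ℂ} (hγ : IsMotion l γ) (t : ℝ) :
    HasStrictDerivAt γ (field (l 3) (γ t)) t :=
  hasStrictDerivAt_of_hasDerivAt_of_continuousAt (Eventually.of_forall fun s => (hγ s).1)
    (((contDiff_field (l 3)).continuous.comp hγ.continuous).continuousAt)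

theorem continuous_cross {X : Type*} [TopologicalSpace X] {f g : X → ℂ} (hf : Continuous f)
    (hg : Continuous g) : Continuous fun x => cross (f x) (g x) :=
  contDiff_cross.continuous.comp (hf.prodMk hg)

theorem HasStrictDerivAt.cross_const {f : ℝ → ℂ} {f' : ℂ} {t : ℝ} (a : ℂ)
    (h : HasStrictDerivAt f f' t) : HasStrictDerivAt (fun s => cross a (f s)) (cross a f') t :=
  imCLM.hasStrictFDerivAt.comp_hasStrictDerivAt t (h.const_mul (conj a))

theorem cross_self_mul (a : ℂ) (r : ℝ) : cross a (I * a * r) = normSq a * r := by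
  simp [cross_re_im, normSq_apply]; ring

/-- The configurations near a point of a motion belong to the motion. -/
theorem IsMotion.eventually_mem_range (hl : IsLinkage l) (hT : T₁ l * T₂ l * T₃ l < 0)
    {γ : ℝ → ℂ × ℂ} (hγ : IsMotion l γ) (t₀ : ℝ) :
    ∀ᶠ x in 𝓝 (γ t₀), x ∈ curve l → x ∈ Set.range γ := by
  set p := γ t₀ with hp
  have hpc : p ∈ curve l := (hγ t₀).2
  have h1 : HasStrictDerivAt (fun t => (γ t).1) (field (l 3) p).1 t₀ :=
    (ContinuousLinearMap.fst ℝ ℂ ℂ).hasStrictFDerivAt.comp_hasStrictDerivAt t₀ (hγ.hasStrictDerivAt t₀)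
  have h2 : HasStrictDerivAt (fun t => (γ t).2) (field (l 3) p).2 t₀ :=
    (ContinuousLinearMap.snd ℝ ℂ ℂ).hasStrictFDerivAt.comp_hasStrictDerivAt t₀ (hγ.hasStrictDerivAt t₀)
  have hf0 := fst_ne_zero hl hpc
  have hs0 := sub_ne_zero.2 (snd_ne_ground hl hpc)
  have hpos : ∀ {a : ℂ}, a ≠ 0 → 0 < (conj a * a).re := fun {a} ha => by
    rw [← normSq_eq_conj_mul_self, ofReal_re]; exact normSq_pos.2 ha
  rcases cross_ne_zero_or hl hT hpc with hP | hQ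
  · have h3 := (HasStrictDerivAt.cross_const p.1 h1).map_nhds_eq (by
      rw [field, cross_self_mul]
      exact mul_ne_zero (normSq_pos.2 hf0).ne' hP)
    -- Inside `N` the local coordinate determines vertex 1, and the fixed orientation of the
    -- triangle 1, 2, 3 then determines vertex 2.
    set N : Set (ℂ × ℂ) := {x | 0 < (conj p.1 * x.1).re ∧
      0 < cross (x.1 - l 3) (x.2 - l 3) * cross (p.1 - l 3) (p.2 - l 3)} with hN
    have hNp : N ∈ 𝓝 p := by
      refine IsOpen.mem_nhds ?_ ⟨hpos hf0, mul_self_pos.2 hP⟩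
      have c1 : Continuous fun x : ℂ × ℂ => (conj p.1 * x.1).re := by fun_prop
      have c2 : Continuous fun x : ℂ × ℂ => cross (x.1 - l 3) (x.2 - l 3) :=
        continuous_cross (by fun_prop) (by fun_prop)
      exact (isOpen_lt continuous_const c1).inter
        (isOpen_lt continuous_const (c2.mul continuous_const))
    have hNt : γ ⁻¹' N ∈ 𝓝 t₀ := hγ.continuous.continuousAt hNp
    have h4 := image_mem_map (m := fun t => cross p.1 (γ t).1) hNt
    rw [h3] at h4
    have h5 : Continuous fun x : ℂ × ℂ => cross p.1 x.1 := continuous_cross (by fun_prop) (by fun_prop)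
    filter_upwards [hNp, h5.continuousAt.preimage_mem_nhds h4] with x hx hx2 hxc
    obtain ⟨t, ht, htx⟩ := hx2
    refine ⟨t, ?_⟩
    have hc := (hγ t).2
    have e1 : (γ t).1 = x.1 := eq_of_cross_eq hf0 htx (hc.1.trans hxc.1.symm) ht.1 hx.1
    refine Prod.ext e1 ?_
    have e2 : (γ t).2 - l 3 = x.2 - l 3 := by
      refine eq_of_norm_eq (sub_ne_zero.2 (fst_ne_ground hl hT hxc)) (hc.2.2.trans hxc.2.2.symm) ?_ ?_
      · rw [sub_sub_sub_cancel_right, sub_sub_sub_cancel_right, hxc.2.1, ← hc.2.1, e1]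
      · have := mul_pos ht.2 hx.2
        rw [e1] at this
        exact pos_of_mul_pos_left (b := cross (p.1 - l 3) (p.2 - l 3) ^ 2)
          (by linarith) (sq_nonneg _)
    exact sub_left_inj.1 e2
  · have h3 := (HasStrictDerivAt.cross_const (p.2 - l 3) (h2.sub_const (l 3 : ℂ))).map_nhds_eq (by
      rw [field, cross_self_mul]
      exact mul_ne_zero (normSq_pos.2 hs0).ne' hQ)
    set N : Set (ℂ × ℂ) := {x | 0 < (conj (p.2 - l 3) * (x.2 - l 3)).re ∧
      0 < cross x.1 x.2 * cross p.1 p.2} with hN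
    have hNp : N ∈ 𝓝 p := by
      refine IsOpen.mem_nhds ?_ ⟨hpos hs0, mul_self_pos.2 hQ⟩
      have c1 : Continuous fun x : ℂ × ℂ => (conj (p.2 - l 3) * (x.2 - l 3)).re := by fun_prop
      exact (isOpen_lt continuous_const c1).inter
        (isOpen_lt continuous_const (contDiff_cross.continuous.mul continuous_const))
    have hNt : γ ⁻¹' N ∈ 𝓝 t₀ := hγ.continuous.continuousAt hNp
    have h4 := image_mem_map (m := fun t => cross (p.2 - l 3) ((γ t).2 - l 3)) hNt
    rw [h3] at h4
    have h5 : Continuous fun x : ℂ × ℂ => cross (p.2 - l 3) (x.2 - l 3) :=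
      continuous_cross (by fun_prop) (by fun_prop)
    filter_upwards [hNp, h5.continuousAt.preimage_mem_nhds h4] with x hx hx2 hxc
    obtain ⟨t, ht, htx⟩ := hx2
    refine ⟨t, ?_⟩
    have hc := (hγ t).2
    have e2 : (γ t).2 = x.2 :=
      sub_left_inj.1 (eq_of_cross_eq hs0 htx (hc.2.2.trans hxc.2.2.symm) ht.1 hx.1)
    refine Prod.ext ?_ e2
    refine eq_of_norm_eq (snd_ne_zero hl hT hxc) (hc.1.trans hxc.1.symm) ?_ ?_
    · rw [norm_sub_rev, norm_sub_rev x.2, hxc.2.1, ← hc.2.1, e2]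
    · have := mul_pos ht.2 hx.2
      rw [e2] at this
      have hcomm : ∀ a b, cross a b = -cross b a := fun a b => by
        rw [cross_re_im, cross_re_im]; ring
      rw [hcomm x.2, hcomm x.2]
      exact pos_of_mul_pos_left (b := cross p.1 p.2 ^ 2) (by linarith) (sq_nonneg _)

/-- Ranges of motions are relatively open and, by uniqueness, equal or disjoint; a connected curve
admits only one. -/
theorem IsMotion.range_eq (hl : IsLinkage l) (hT : T₁ l * T₂ l * T₃ l < 0)
    (hconn : IsPreconnected (curve l)) {γ : ℝ → ℂ × ℂ} (hγ : IsMotion l γ) :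
    Set.range γ = curve l := by
  refine Set.Subset.antisymm (Set.range_subset_iff.2 fun t => (hγ t).2) ?_
  have := isPreconnected_iff_preconnectedSpace.1 hconn
  set S : Set (curve l) := {x | (x : ℂ × ℂ) ∈ Set.range γ} with hS
  have hopen : ∀ {δ : ℝ → ℂ × ℂ}, IsMotion l δ → ∀ x : curve l, (x : ℂ × ℂ) ∈ Set.range δ →
      ∀ᶠ y : curve l in 𝓝 x, (y : ℂ × ℂ) ∈ Set.range δ := by
    rintro δ hδ x ⟨t, ht⟩
    have h := hδ.eventually_mem_range hl hT t
    rw [ht] at h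
    filter_upwards [continuous_subtype_val.continuousAt.eventually h] with y hy using hy y.2
  have hclopen : IsClopen S := by
    refine ⟨⟨isOpen_iff_mem_nhds.2 fun x hx => ?_⟩, isOpen_iff_mem_nhds.2 fun x hx => hopen hγ x hx⟩
    obtain ⟨δ, hδ, hδ0⟩ := exists_motion hl x.2
    filter_upwards [hopen hδ x ⟨0, hδ0⟩] with y hy hyS
    obtain ⟨s, hs⟩ := hy
    obtain ⟨t, ht⟩ := hyS
    apply hx
    have h := (hγ.shift t).eq (hδ.shift s) (t := 0) (by simp [hs, ht])
    refine ⟨-s + t, ?_⟩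
    have := congrFun h (-s)
    simpa [hδ0] using this
  have huniv := hclopen.eq_univ ⟨⟨γ 0, (hγ 0).2⟩, 0, rfl⟩
  intro x hx
  have : (⟨x, hx⟩ : curve l) ∈ S := huniv ▸ Set.mem_univ _
  exact this

/-! ### Connectedness of the configuration curve. -/

/-- Sixteen times the squared area of a triangle with sides `r`, `m`, `√D`. -/
def heron (r m D : ℝ) : ℝ := 4 * r ^ 2 * D - (r ^ 2 + D - m ^ 2) ^ 2

/-- The third vertex of the triangle with vertices `0` and `a` whose other sides have lengths `r`
and `m`; the sign `s` is its orientation. -/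
noncomputable def third (s r m : ℝ) (a : ℂ) : ℂ :=
  a * (((r ^ 2 + normSq a - m ^ 2) + s * √(heron r m (normSq a)) * I) / (2 * normSq a))

theorem third_mul (s r m : ℝ) {a : ℂ} (ha : a ≠ 0) : third s r m a * (2 * conj a) =
    (((r ^ 2 + normSq a - m ^ 2 : ℝ)) : ℂ) + ((s * √(heron r m (normSq a)) : ℝ) : ℂ) * I := by
  have hca : conj a ≠ 0 := (map_ne_zero _).2 ha
  rw [third, ← mul_conj]
  push_cast
  rw [← mul_conj]
  field_simp

theorem norm_third {s r m : ℝ} {a : ℂ} (ha : a ≠ 0) (hs : s ^ 2 = 1) (hr : 0 ≤ r) (hm : 0 ≤ m)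
    (hΔ : 0 ≤ heron r m (normSq a)) : ‖third s r m a‖ = r ∧ ‖a - third s r m a‖ = m := by
  have hD : 0 < normSq a := normSq_pos.2 ha
  have h := third_mul s r m ha
  set b := third s r m a
  have hre : 2 * (a.re * b.re + a.im * b.im) = r ^ 2 + normSq a - m ^ 2 := by
    have := congrArg re h
    simp only [mul_re, mul_im, add_re, conj_re, conj_im, ofReal_re, ofReal_im, I_re, I_im, re_ofNat,
      im_ofNat] at this
    linarith
  have h1 : normSq b = r ^ 2 := by
    have := congrArg normSq h
    rw [normSq_add_mul_I, mul_pow, hs, Real.sq_sqrt hΔ, heron, normSq_mul, normSq_mul, normSq_conj] at this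
    simp only [normSq_ofNat] at this
    have h3 : normSq a * (normSq b - r ^ 2) = 0 := by linear_combination this / 4
    rcases mul_eq_zero.1 h3 with h4 | h4 <;> linarith
  refine ⟨(sq_eq_sq₀ (norm_nonneg _) hr).1 (by rw [← normSq_eq_norm_sq, h1]),
    (sq_eq_sq₀ (norm_nonneg _) hm).1 ?_⟩
  rw [← normSq_eq_norm_sq]
  simp only [normSq_apply, sub_re, sub_im] at hre h1 ⊢
  linear_combination h1 - hre

theorem eq_third {r m : ℝ} {a b : ℂ} (ha : a ≠ 0) (hb : ‖b‖ = r) (hab : ‖a - b‖ = m) :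
    0 ≤ heron r m (normSq a) ∧ ∃ s : ℝ, (s = 1 ∨ s = -1) ∧ b = third s r m a := by
  have h1 : normSq b = r ^ 2 := by rw [normSq_eq_norm_sq, hb]
  have h2 : normSq (a - b) = m ^ 2 := by rw [normSq_eq_norm_sq, hab]
  have hre : 2 * (a.re * b.re + a.im * b.im) = r ^ 2 + normSq a - m ^ 2 := by
    simp only [normSq_apply, sub_re, sub_im] at h1 h2 ⊢
    linarith
  have hΔ : heron r m (normSq a) = (2 * cross a b) ^ 2 := by
    rw [heron, ← hre, ← h1, cross_re_im, normSq_apply, normSq_apply]; ring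
  have hca : 2 * conj a ≠ 0 := mul_ne_zero two_ne_zero ((map_ne_zero _).2 ha)
  refine ⟨hΔ ▸ sq_nonneg _, ?_⟩
  have key : ∀ s : ℝ, s * |2 * cross a b| = 2 * cross a b → b = third s r m a := fun s hs => by
    refine mul_right_cancel₀ hca ?_
    rw [third_mul s r m ha, hΔ, Real.sqrt_sq_eq_abs, hs, ← hre]
    apply Complex.ext
    · simp; ring
    · simp [cross_re_im]; ring
  rcases le_total 0 (2 * cross a b) with h | h
  · exact ⟨1, Or.inl rfl, key 1 (by rw [abs_of_nonneg h, one_mul])⟩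
  · exact ⟨-1, Or.inr rfl, key (-1) (by rw [abs_of_nonpos h]; ring)⟩

theorem continuousAt_third (s r m : ℝ) {a : ℂ} (ha : a ≠ 0) : ContinuousAt (third s r m) a := by
  have hD : (2 * normSq a : ℂ) ≠ 0 := by
    simpa using ha
  have hn : Continuous fun a : ℂ => (normSq a : ℂ) := continuous_ofReal.comp continuous_normSq
  have hh : Continuous fun a : ℂ => ((√(heron r m (normSq a)) : ℝ) : ℂ) := by
    refine continuous_ofReal.comp (Real.continuous_sqrt.comp ?_)
    unfold heron
    have := continuous_normSq
    fun_prop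
  unfold third
  exact continuousAt_id.mul (ContinuousAt.div (by fun_prop) (by fun_prop) hD)

/-- Position of the vertex `1`. -/
noncomputable def crank (l : Fin 4 → ℝ) (σ φ : ℝ) : ℂ := (σ * l 0 : ℝ) * exp (φ * I)

/-- Configurations with given angle at the vertex `0` and given orientation of the triangle
`1, 2, 3`. -/
noncomputable def branch (l : Fin 4 → ℝ) (σ s φ : ℝ) : ℂ × ℂ :=
  (crank l σ φ, l 3 + third s (l 2) (l 1) (crank l σ φ - l 3))

theorem normSq_crank_sub {σ : ℝ} (hσ : σ ^ 2 = 1) (φ : ℝ) : normSq (crank l σ φ - l 3) =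
    l 0 ^ 2 + l 3 ^ 2 - 2 * σ * l 0 * l 3 * Real.cos φ := by
  rw [normSq_apply]
  simp only [crank, sub_re, sub_im, re_ofReal_mul, im_ofReal_mul, exp_ofReal_mul_I_re,
    exp_ofReal_mul_I_im, ofReal_re, ofReal_im]
  linear_combination (l 0 ^ 2) * hσ + σ ^ 2 * l 0 ^ 2 * Real.sin_sq_add_cos_sq φ

theorem norm_crank (hl : IsLinkage l) {σ : ℝ} (hσ : σ = 1 ∨ σ = -1) (φ : ℝ) :
    ‖crank l σ φ‖ = l 0 := by
  rw [crank, norm_mul, norm_exp_ofReal_mul_I, mul_one, norm_real, Real.norm_eq_abs, abs_mul,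
    abs_of_pos (hl.pos 0)]
  rcases hσ with rfl | rfl <;> simp

theorem branch_mem_curve (hl : IsLinkage l) {σ s φ : ℝ} (hσ : σ = 1 ∨ σ = -1) (hs : s ^ 2 = 1)
    (h0 : crank l σ φ - l 3 ≠ 0)
    (hΔ : 0 ≤ heron (l 2) (l 1) (normSq (crank l σ φ - l 3))) : branch l σ s φ ∈ curve l := by
  have h := norm_third h0 hs (hl.pos 2).le (hl.pos 1).le hΔ
  refine ⟨norm_crank hl hσ φ, ?_, ?_⟩
  · rw [branch, ← sub_sub, h.2]
  · rw [branch, add_sub_cancel_left, h.1]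

theorem popTwo_branch {σ s φ : ℝ} (h0 : crank l σ φ - l 3 ≠ 0)
    (hΔ : heron (l 2) (l 1) (normSq (crank l σ φ - l 3)) = 0) :
    popTwo (l 3) (branch l σ s φ) = branch l σ s φ := by
  have hc : conj (crank l σ φ - l 3) ≠ 0 := (map_ne_zero _).2 h0
  refine Prod.ext rfl ?_
  simp only [popTwo, branch, add_sub_cancel_left, third, hΔ, Real.sqrt_zero]
  set a := crank l σ φ - l 3
  congr 1
  simp only [map_mul, map_div₀, map_sub, map_add, map_pow, conj_ofReal, conj_ofNat, ofReal_zero, mul_zero,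
    zero_mul, map_zero]
  field_simp

/-- The admissible crank angles form one arc `|φ| ≤ θ`. Over it lie two copies, one per orientation
of the triangle 1, 2, 3, glued where that triangle degenerates. The sign `σ` turns the reference
direction so that the arc is centred at `φ = 0`. -/
theorem curve_of_heron (hl : IsLinkage l) (hT : T₁ l * T₂ l * T₃ l < 0) {σ m : ℝ}
    (hσ : σ = 1 ∨ σ = -1) (hm : m ∈ Set.Ioo (-1 : ℝ) 1)
    (hΔ : ∀ φ, 0 ≤ heron (l 2) (l 1) (normSq (crank l σ φ - l 3)) ↔ m ≤ Real.cos φ)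
    (hΔ0 : ∀ φ, Real.cos φ = m → heron (l 2) (l 1) (normSq (crank l σ φ - l 3)) = 0) :
    IsPreconnected (curve l) ∧ ∃ p ∈ curve l, ∃ q ∈ curve l, p ≠ q ∧
      popTwo (l 3) p = p ∧ popTwo (l 3) q = q := by
  have hσ2 : σ ^ 2 = 1 := by rcases hσ with rfl | rfl <;> norm_num
  set θ := Real.arccos m with hθ
  have hcosθ : Real.cos θ = m := Real.cos_arccos hm.1.le hm.2.le
  have hθ0 : 0 < θ := Real.arccos_pos.2 hm.2
  have hθπ : θ < Real.pi := by
    refine lt_of_le_of_ne (Real.arccos_le_pi _) fun h => ?_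
    rw [h, Real.cos_pi] at hcosθ
    linarith [hm.1]
  have harc : ∀ φ ∈ Set.Icc (-θ) θ, m ≤ Real.cos φ := fun φ hφ => by
    rw [← hcosθ, ← Real.cos_abs φ]
    exact Real.cos_le_cos_of_nonneg_of_le_pi (abs_nonneg _) hθπ.le (abs_le.2 hφ)
  have hne : ∀ φ ∈ Set.Icc (-θ) θ, crank l σ φ - l 3 ≠ 0 := fun φ hφ h0 => by
    have h1 := (hΔ φ).2 (harc φ hφ)
    rw [h0, normSq_zero, heron] at h1
    have h2 : l 2 ^ 2 = l 1 ^ 2 := by nlinarith [sq_nonneg (l 2 ^ 2 - l 1 ^ 2)]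
    have h3 : l 2 = l 1 := (sq_eq_sq₀ (hl.pos 2).le (hl.pos 1).le).1 h2
    have h4 := norm_crank hl hσ φ
    rw [sub_eq_zero.1 h0, norm_real, Real.norm_eq_abs, abs_of_pos (hl.pos 3)] at h4
    have : T₂ l = 0 := by simp only [T₂]; linarith
    simp [this] at hT
  have hmem : ∀ s : ℝ, s ^ 2 = 1 → ∀ φ ∈ Set.Icc (-θ) θ, branch l σ s φ ∈ curve l :=
    fun s hs φ hφ => branch_mem_curve hl hσ hs (hne φ hφ) ((hΔ φ).2 (harc φ hφ))
  have hθmem : θ ∈ Set.Icc (-θ) θ := ⟨by linarith, le_rfl⟩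
  have hθmem' : -θ ∈ Set.Icc (-θ) θ := ⟨le_rfl, by linarith⟩
  refine ⟨?_, branch l σ 1 θ, hmem 1 (by norm_num) θ hθmem, branch l σ 1 (-θ),
    hmem 1 (by norm_num) _ hθmem', fun h => ?_, popTwo_branch (hne θ hθmem) (hΔ0 θ hcosθ),
    popTwo_branch (hne _ hθmem') (hΔ0 _ (by rw [Real.cos_neg, hcosθ]))⟩
  · have hcrank : Continuous (crank l σ) := by unfold crank; fun_prop
    have hpre : ∀ s : ℝ, IsPreconnected (branch l σ s '' Set.Icc (-θ) θ) := fun s => by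
      refine isPreconnected_Icc.image _ fun φ hφ => ContinuousAt.continuousWithinAt ?_
      refine hcrank.continuousAt.prodMk (continuousAt_const.add ?_)
      exact ContinuousAt.comp (f := fun x => crank l σ x - l 3) (continuousAt_third s _ _ (hne φ hφ))
        (by fun_prop)
    have hcurve : curve l = branch l σ 1 '' Set.Icc (-θ) θ ∪ branch l σ (-1) '' Set.Icc (-θ) θ := by
      refine Set.Subset.antisymm (fun p hp => ?_) (Set.union_subset ?_ ?_)
      · set φ := arg (σ * p.1) with hφ
        have hp1 : p.1 = crank l σ φ := by
          have h1 := norm_mul_exp_arg_mul_I (σ * p.1)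
          rw [norm_mul, hp.1, norm_real, Real.norm_eq_abs, ← hφ] at h1
          have h2 : |σ| = 1 := by rcases hσ with rfl | rfl <;> simp
          have h3 : (σ : ℂ) * σ = 1 := by rw [← sq]; exact_mod_cast hσ2
          rw [h2, one_mul] at h1
          rw [crank, ofReal_mul, mul_assoc, h1, ← mul_assoc, h3, one_mul]
        have h4 : crank l σ φ - l 3 ≠ 0 := hp1 ▸ sub_ne_zero.2 (fst_ne_ground hl hT hp)
        obtain ⟨h5, s, hs, h6⟩ := eq_third (b := p.2 - l 3) h4 hp.2.2
          (by rw [← hp1, sub_sub_sub_cancel_right, hp.2.1])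
        have h7 : p = branch l σ s φ := Prod.ext hp1 (by rw [branch, ← h6]; ring)
        have h8 : φ ∈ Set.Icc (-θ) θ := by
          refine abs_le.1 ?_
          rw [← Real.arccos_cos (abs_nonneg φ) (abs_arg_le_pi _), Real.cos_abs]
          exact Real.arccos_le_arccos ((hΔ φ).1 h5)
        rcases hs with rfl | rfl
        · exact Or.inl ⟨φ, h8, h7.symm⟩
        · exact Or.inr ⟨φ, h8, h7.symm⟩
      · exact Set.image_subset_iff.2 (hmem 1 (by norm_num))
      · exact Set.image_subset_iff.2 (hmem (-1) (by norm_num))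
    rw [hcurve]
    refine IsPreconnected.union (branch l σ 1 θ) ⟨θ, hθmem, rfl⟩ ⟨θ, hθmem, ?_⟩ (hpre 1) (hpre (-1))
    simp [branch, third, hΔ0 θ hcosθ]
  · have h1 := congrArg (fun p : ℂ × ℂ => p.1.im) h
    simp only [branch, crank, im_ofReal_mul, exp_ofReal_mul_I_im, Real.sin_neg] at h1
    have h2 := Real.sin_pos_of_pos_of_lt_pi hθ0 hθπ
    have h3 : σ * l 0 ≠ 0 := mul_ne_zero (by rcases hσ with rfl | rfl <;> norm_num) (hl.pos 0).ne'
    have h4 : σ * l 0 * Real.sin θ = 0 := by linarith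
    exact (mul_ne_zero h3 h2.ne') h4

theorem heron_eq (r m D : ℝ) : heron r m D = ((m + r) ^ 2 - D) * (D - (m - r) ^ 2) := by
  unfold heron; ring

/-- The curve of configurations of a non-Grashof linkage is connected, and the triangle `1, 2, 3`
degenerates in two of the configurations. -/
theorem isPreconnected_curve (hl : IsLinkage l) (hT : T₁ l * T₂ l * T₃ l < 0) :
    IsPreconnected (curve l) ∧ ∃ p ∈ curve l, ∃ q ∈ curve l, p ≠ q ∧
      popTwo (l 3) p = p ∧ popTwo (l 3) q = q := by
  have p0 := hl.pos 0
  have p1 := hl.pos 1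
  have p2 := hl.pos 2
  have p3 := hl.pos 3
  have e1 := hl.lower₁
  have e2 := hl.lower₂
  have e3 := hl.lower₃
  have e4 := hl.upper
  have p03 : 0 < 2 * l 0 * l 3 := by positivity
  -- The squared diagonal from 1 to 3 must lie between `(l₁ - L)²` and `(l₁ + L)²`, and between `(l₂
  -- - l₃)²` and `(l₂ + l₃)²`. The sign of `T₁T₂` compares the lower ends, that of `T₃` the upper
  -- ends; a negative product means that exactly one end of the crank's range is cut off.
  have hac : (l 0 - l 3) ^ 2 - (l 1 - l 2) ^ 2 = T₁ l * T₂ l := by simp only [T₁, T₂]; ring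
  have heb : (l 1 + l 2) ^ 2 - (l 0 + l 3) ^ 2 = T₃ l * (l 0 + l 1 + l 2 + l 3) := by
    simp only [T₃]; ring
  have hS : 0 < l 0 + l 1 + l 2 + l 3 := by linarith
  have hae : (l 0 - l 3) ^ 2 < (l 1 + l 2) ^ 2 := by nlinarith
  have hcb : (l 1 - l 2) ^ 2 < (l 0 + l 3) ^ 2 := by nlinarith
  rcases lt_or_ge (T₃ l) 0 with h3 | h3
  · have h12 : 0 < T₁ l * T₂ l := pos_of_mul_neg_left hT h3.le
    have hbe : (l 1 + l 2) ^ 2 < (l 0 + l 3) ^ 2 := by nlinarith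
    refine curve_of_heron hl hT (σ := 1) (m := (l 0 ^ 2 + l 3 ^ 2 - (l 1 + l 2) ^ 2) / (2 * l 0 * l 3))
      (Or.inl rfl) ⟨?_, ?_⟩ (fun φ => ?_) (fun φ hφ => ?_)
    · rw [lt_div_iff₀ p03]; nlinarith
    · rw [div_lt_iff₀ p03]; nlinarith
    · rw [heron_eq, normSq_crank_sub (by norm_num), div_le_iff₀ p03]
      have hc := Real.cos_le_one φ
      have : 0 < l 0 ^ 2 + l 3 ^ 2 - 2 * 1 * l 0 * l 3 * Real.cos φ - (l 1 - l 2) ^ 2 := by nlinarith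
      rw [mul_nonneg_iff_of_pos_right this]
      constructor <;> intro h <;> linarith
    · rw [eq_div_iff p03.ne'] at hφ
      rw [heron_eq, normSq_crank_sub (by norm_num)]
      refine mul_eq_zero_of_left ?_ _
      linarith
  · have h3' : 0 < T₃ l := lt_of_le_of_ne h3 fun h => by simp [← h] at hT
    have h12 : T₁ l * T₂ l < 0 := neg_of_mul_neg_left hT h3
    have hbe : (l 0 + l 3) ^ 2 < (l 1 + l 2) ^ 2 := by nlinarith
    refine curve_of_heron hl hT (σ := -1) (m := ((l 1 - l 2) ^ 2 - l 0 ^ 2 - l 3 ^ 2) / (2 * l 0 * l 3))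
      (Or.inr rfl) ⟨?_, ?_⟩ (fun φ => ?_) (fun φ hφ => ?_)
    · rw [lt_div_iff₀ p03]; nlinarith
    · rw [div_lt_iff₀ p03]; nlinarith
    · rw [heron_eq, normSq_crank_sub (by norm_num), div_le_iff₀ p03]
      have hc := Real.cos_le_one φ
      have : 0 < (l 1 + l 2) ^ 2 - (l 0 ^ 2 + l 3 ^ 2 - 2 * (-1) * l 0 * l 3 * Real.cos φ) := by nlinarith
      rw [mul_nonneg_iff_of_pos_left this]
      constructor <;> intro h <;> linarith
    · rw [eq_div_iff p03.ne'] at hφ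
      rw [heron_eq, normSq_crank_sub (by norm_num)]
      refine mul_eq_zero_of_right _ ?_
      linarith

/-! ### Periodicity and density. -/

/-- If a motion passes through all configurations, it is periodic. -/
theorem IsMotion.exists_period (hl : IsLinkage l) (hT : T₁ l * T₂ l * T₃ l < 0)
    {γ : ℝ → ℂ × ℂ} (hγ : IsMotion l γ) (hrange : Set.range γ = curve l)
    (hfix : ∃ p ∈ curve l, ∃ q ∈ curve l, p ≠ q ∧ popTwo (l 3) p = p ∧ popTwo (l 3) q = q) :
    ∃ P : ℝ, 0 < P ∧ Function.Periodic γ P := by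
  obtain ⟨p, hp, q, hq, hpq, hpf, hqf⟩ := hfix
  rw [← hrange] at hp hq
  obtain ⟨t, rfl⟩ := hp
  obtain ⟨u, rfl⟩ := hq
  have h0 : popTwo (l 3) (γ 0) ∈ Set.range γ := hrange ▸ popTwo_mem hl hT (hγ 0).2
  obtain ⟨s, hs⟩ := h0
  have hrefl := (hγ.popTwo_neg hl hT).eq (hγ.shift s) (t := 0) (by simp [hs])
  -- On the time line the pop acts as `t ↦ s - t`. A fixed configuration at time `t` makes `s - 2t`
  -- a period, possibly zero; two distinct fixed configurations give a nonzero difference.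
  have hper : ∀ t, popTwo (l 3) (γ t) = γ t → Function.Periodic γ (s - 2 * t) := fun t ht => by
    have h1 := congrFun hrefl (-t)
    simp only [neg_neg, ht] at h1
    have h2 := (hγ.shift (s - 2 * t)).eq hγ (t := t) (by
      rw [h1]; congr 1; ring)
    exact fun x => congrFun h2 x
  have h3 : Function.Periodic γ (2 * (t - u)) := by
    rw [show 2 * (t - u) = s - 2 * u - (s - 2 * t) by ring]
    exact (hper u hqf).sub_period (hper t hpf)
  have hne : 2 * (t - u) ≠ 0 := fun h => hpq (by rw [show t = u by linarith])
  rcases lt_or_gt_of_ne hne with h | h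
  · exact ⟨-(2 * (t - u)), by linarith, h3.neg⟩
  · exact ⟨_, h, h3⟩

/-- If alternate pops do not return to some configuration, they come close to all of them. -/
theorem canReachNeighborhood_of_iterate_ne (hl : IsLinkage l) (hT : T₁ l * T₂ l * T₃ l < 0)
    {x : ℂ × ℂ} (hx : x ∈ curve l) (hne : ∀ n : ℕ, 0 < n → (popBoth (l 3))^[n] x ≠ x)
    {C' : Quad} (hC' : IsConfiguration l C') : CanReachNeighborhood l 1 C' := by
  obtain ⟨γ, hγ, -⟩ := exists_motion hl hx
  obtain ⟨hconn, hfix⟩ := isPreconnected_curve hl hT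
  have hrange := hγ.range_eq hl hT hconn
  obtain ⟨P, hP, hper⟩ := hγ.exists_period hl hT hrange hfix
  have h0 : popBoth (l 3) (γ 0) ∈ Set.range γ := hrange ▸ popBoth_mem hl hT (hγ 0).2
  obtain ⟨d, hd⟩ := h0
  have hshift := (hγ.popBoth hl hT).eq (hγ.shift d) (t := 0) (by simp [hd])
  have hiter : ∀ (n : ℕ) (t : ℝ), (popBoth (l 3))^[n] (γ t) = γ (t + n * d) := by
    intro n t
    induction n with
    | zero => simp
    | succ n ih =>
      rw [Function.iterate_succ_apply', ih]
      refine (congrFun hshift _).trans ?_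
      push_cast
      ring_nf
  -- If `n * d` were a multiple of the period, `n` double pops would fix every configuration, in
  -- particular `x`.
  have hirr : ∀ n : ℕ, 0 < n → ∀ m : ℤ, n * d ≠ m * P := by
    intro n hn m h
    obtain ⟨t, rfl⟩ : x ∈ Set.range γ := hrange ▸ hx
    refine hne n hn ?_
    rw [hiter, h]
    exact hper.int_mul m t
  intro C hC ε hε
  obtain ⟨p, hp, rfl⟩ := hC.exists_mem_curve
  obtain ⟨p', hp', rfl⟩ := hC'.exists_mem_curve
  obtain ⟨t, rfl⟩ : p ∈ Set.range γ := hrange ▸ hp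
  obtain ⟨t', rfl⟩ : p' ∈ Set.range γ := hrange ▸ hp'
  obtain ⟨δ, hδ, hδε⟩ := Metric.continuousAt_iff.1 (hγ.continuous.continuousAt (x := t')) ε hε
  obtain ⟨n, m, hnm⟩ := exists_nsmul_near hP hirr (t' - t) δ hδ
  obtain ⟨hmem, heq⟩ := iterate_pop_toQuad hl hT n hp
  have hclose : dist ((popBoth (l 3))^[n] (γ t)) (γ t') < ε := by
    rw [hiter, ← hper.int_mul m]
    refine hδε ?_
    rw [Real.dist_eq]
    convert hnm using 2
    ring
  have hmove : ∀ D : Quad, move 1 0 D = D := fun D => by ext i; simp [move]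
  -- Pops of 1 and 2 leave the ground link in place, so the rigid motion is the identity.
  refine ⟨n, 1, 0, ?_, fun i => ?_⟩
  · rw [hmove, heq]
    exact isConfiguration_toQuad (hl.pos 3) hmem
  · rw [hmove, heq]
    rw [Prod.dist_eq, max_lt_iff] at hclose
    fin_cases i
    · simpa [toQuad] using hε.le
    · simpa [toQuad] using hclose.1.le
    · simpa [toQuad] using hclose.2.le
    · simpa [toQuad] using hε.le

/-! ### Rational functions of real variables. -/

/-- A complex valued function of `m` real variables that agrees with a quotient of polynomials where
the denominator does not vanish. -/
def IsRat {m : ℕ} (f : (Fin m → ℝ) → ℂ) : Prop :=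
  ∃ p q : MvPolynomial (Fin m) ℂ, q ≠ 0 ∧ ∀ x : Fin m → ℝ, q.eval (fun i => (x i : ℂ)) ≠ 0 →
    f x = p.eval (fun i => (x i : ℂ)) / q.eval (fun i => (x i : ℂ))

namespace IsRat

variable {m : ℕ} {f g : (Fin m → ℝ) → ℂ}

theorem const (c : ℂ) : IsRat (fun _ : Fin m → ℝ => c) :=
  ⟨MvPolynomial.C c, 1, one_ne_zero, fun x _ => by simp⟩

theorem coord (i : Fin m) : IsRat (fun x => (x i : ℂ)) :=
  ⟨MvPolynomial.X i, 1, one_ne_zero, fun x _ => by simp⟩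

theorem add (hf : IsRat f) (hg : IsRat g) : IsRat (fun x => f x + g x) := by
  obtain ⟨p, q, hq, h⟩ := hf
  obtain ⟨p', q', hq', h'⟩ := hg
  refine ⟨p * q' + q * p', q * q', mul_ne_zero hq hq', fun x hx => ?_⟩
  rw [map_mul] at hx
  have h1 := left_ne_zero_of_mul hx
  have h2 := right_ne_zero_of_mul hx
  simp only [h x h1, h' x h2]
  rw [map_add, map_mul, map_mul, map_mul, div_add_div _ _ h1 h2]

theorem mul (hf : IsRat f) (hg : IsRat g) : IsRat (fun x => f x * g x) := by
  obtain ⟨p, q, hq, h⟩ := hf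
  obtain ⟨p', q', hq', h'⟩ := hg
  refine ⟨p * p', q * q', mul_ne_zero hq hq', fun x hx => ?_⟩
  rw [map_mul] at hx
  simp only [h x (left_ne_zero_of_mul hx), h' x (right_ne_zero_of_mul hx)]
  rw [map_mul, map_mul,
    div_mul_div_comm]

theorem sub (hf : IsRat f) (hg : IsRat g) : IsRat (fun x => f x - g x) := by
  simpa [sub_eq_add_neg] using hf.add ((const (-1)).mul hg)

theorem inv (hf : IsRat f) : IsRat (fun x => (f x)⁻¹) := by
  obtain ⟨p, q, hq, h⟩ := hf
  by_cases hp : p = 0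
  · exact ⟨0, q, hq, fun x hx => by simp [h x hx, hp]⟩
  -- The common factor `q` makes the new denominator vanish wherever the old one does.
  · refine ⟨q * q, p * q, mul_ne_zero hp hq, fun x hx => ?_⟩
    rw [map_mul] at hx
    have h1 := right_ne_zero_of_mul hx
    simp only [h x h1]
    rw [map_mul, map_mul, inv_div, mul_div_mul_right _ _ h1]

theorem div (hf : IsRat f) (hg : IsRat g) : IsRat (fun x => f x / g x) := by
  simpa [div_eq_mul_inv] using hf.mul hg.inv

/-- At real arguments conjugation only acts on the coefficients; this is what makes pops rational.
-/
theorem map_conj (hf : IsRat f) : IsRat (fun x => conj (f x)) := by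
  have key : ∀ (p : MvPolynomial (Fin m) ℂ) (x : Fin m → ℝ),
      (p.map (starRingEnd ℂ)).eval (fun i => (x i : ℂ)) =
        starRingEnd ℂ (p.eval (fun i => (x i : ℂ))) := fun p x => by
    induction p using MvPolynomial.induction_on with
    | C a => simp
    | add p q hp hq => simp [hp, hq]
    | mul_X p i hp => simp [hp]
  obtain ⟨p, q, hq, h⟩ := hf
  refine ⟨p.map (starRingEnd ℂ), q.map (starRingEnd ℂ), fun h0 => hq ?_, fun x hx => ?_⟩
  · exact MvPolynomial.map_injective _ (starRingEnd ℂ).injective (by simpa using h0)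
  · rw [key, map_ne_zero] at hx
    simp only [h x hx]
    rw [key, key, map_div₀]

/-- A rational function that does not vanish identically near a point has a null set of zeros. -/
theorem volume_zeros (hf : IsRat f) {x₀ : Fin m → ℝ} (hc : ∀ᶠ x in 𝓝 x₀, ContinuousAt f x)
    (hne : ∃ᶠ x in 𝓝 x₀, f x ≠ 0) : volume {x | f x = 0} = 0 := by
  obtain ⟨p, q, hq, h⟩ := hf
  have hq0 := volume_zeros_eq_zero m q hq
  have hp : p ≠ 0 := by
    -- A zero numerator would make `f` vanish on the dense set `q ≠ 0`, contradicting a nonzero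
    -- value at a point of continuity.
    rintro rfl
    have hdense : Dense {x : Fin m → ℝ | q.eval (fun i => (x i : ℂ)) ≠ 0} :=
      Measure.dense_of_ae (measure_eq_zero_iff_ae_notMem.1 hq0)
    obtain ⟨x, hx, hxc⟩ := (hne.and_eventually hc).exists
    obtain ⟨y, hy, hyq⟩ := mem_closure_iff_nhds.1 (hdense x) _ (hxc.eventually_ne hx)
    exact hy (by simpa using h y hyq)
  refine measure_mono_null (fun x hx => ?_) (measure_union_null hq0 (volume_zeros_eq_zero m p hp))
  by_cases hqx : q.eval (fun i => (x i : ℂ)) = 0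
  · exact Or.inl hqx
  · refine Or.inr ?_
    have := h x hqx
    rw [hx, eq_comm, div_eq_zero_iff] at this
    exact this.resolve_right hqx

end IsRat

/-! ### Iterated pops near a flat quadrilateral. -/

/-- The moving vertices of the quadrilateral with ground link of length `x 0` and real coordinates
`x`. -/
noncomputable def vertices (x : Fin 5 → ℝ) : ℂ × ℂ := (x 1 + x 2 * I, x 3 + x 4 * I)

theorem isRat_iterate (n : ℕ) :
    IsRat (fun x : Fin 5 → ℝ => ((popBoth (x 0))^[n] (vertices x)).1) ∧
    IsRat (fun x : Fin 5 → ℝ => ((popBoth (x 0))^[n] (vertices x)).2) := by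
  induction n with
  | zero =>
    exact ⟨(IsRat.coord 1).add ((IsRat.coord 2).mul (IsRat.const I)),
      (IsRat.coord 3).add ((IsRat.coord 4).mul (IsRat.const I))⟩
  | succ n ih =>
    obtain ⟨h1, h2⟩ := ih
    simp only [Function.iterate_succ_apply']
    have h3 := (h2.mul h1.map_conj).div h2.map_conj
    have h4 := h3.sub (IsRat.coord 0)
    exact ⟨h3, (IsRat.coord 0).add ((h4.mul (h2.sub (IsRat.coord 0)).map_conj).div h4.map_conj)⟩

/-- A quadrilateral with all vertices on a line. -/
noncomputable def flatQuad : Fin 5 → ℝ := ![3, 2, 0, 1, 0]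

theorem iterate_flatQuad (n : ℕ) :
    (popBoth (flatQuad 0))^[n] (vertices flatQuad) = (2, 1) := by
  induction n with
  | zero => simp [vertices, flatQuad]
  | succ n ih =>
    rw [Function.iterate_succ_apply', ih]
    simp [popBoth, popOne, popTwo, flatQuad, conj_ofNat]
    norm_num

/-- The denominators are nonzero at the flat quadrilateral, which all iterates fix. Being C¹ there
gives continuity in a whole neighbourhood. -/
theorem contDiffAt_iterate (n : ℕ) :
    ContDiffAt ℝ 1 (fun x : Fin 5 → ℝ => ((popBoth (x 0))^[n] (vertices x)).1) flatQuad ∧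
    ContDiffAt ℝ 1 (fun x : Fin 5 → ℝ => ((popBoth (x 0))^[n] (vertices x)).2) flatQuad := by
  have hcoord : ∀ i, ContDiffAt ℝ 1 (fun x : Fin 5 → ℝ => (x i : ℂ)) flatQuad := fun i =>
    ofRealCLM.contDiff.contDiffAt.comp _ (contDiff_apply ℝ ℝ i).contDiffAt
  have hconj : ∀ {f : (Fin 5 → ℝ) → ℂ}, ContDiffAt ℝ 1 f flatQuad →
      ContDiffAt ℝ 1 (fun x => conj (f x)) flatQuad := fun hf =>
    conjCLE.contDiff.contDiffAt.comp _ hf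
  induction n with
  | zero =>
    exact ⟨(hcoord 1).add ((hcoord 2).mul contDiffAt_const),
      (hcoord 3).add ((hcoord 4).mul contDiffAt_const)⟩
  | succ n ih =>
    obtain ⟨h1, h2⟩ := ih
    have hv1 := congrArg Prod.fst (iterate_flatQuad n)
    have hv2 := congrArg Prod.snd (iterate_flatQuad n)
    simp only [Function.iterate_succ_apply', popBoth, popOne, popTwo, div_eq_mul_inv]
    set f : (Fin 5 → ℝ) → ℂ := fun x => ((popBoth (x 0))^[n] (vertices x)).1
    set g : (Fin 5 → ℝ) → ℂ := fun x => ((popBoth (x 0))^[n] (vertices x)).2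
    have hf : f flatQuad = 2 := hv1
    have hg : g flatQuad = 1 := hv2
    have h3 : ContDiffAt ℝ 1 (fun x => g x * conj (f x) * (conj (g x))⁻¹) flatQuad :=
      (h2.mul (hconj h1)).mul ((hconj h2).inv (by simp [hg]))
    have h4 := h3.sub (hcoord 0)
    have h5 : (flatQuad 0 : ℝ) = 3 := rfl
    refine ⟨h3, (hcoord 0).add ((h4.mul (hconj (h2.sub (hcoord 0)))).mul ((hconj h4).inv ?_))⟩
    simp [hf, hg, h5, conj_ofNat]
    norm_num

/-- Perturbing the flat quadrilateral makes it move away from the line. -/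
theorem hasDerivAt_iterate (n : ℕ) : ∃ y z : ℝ, 0 ≤ y ∧ y ≤ z ∧ 11 ^ n ≤ z ∧
    HasDerivAt (fun ε : ℝ => (popBoth 3)^[n] ((2, 1 + ε * I) : ℂ × ℂ)) (I * y, I * z) 0 := by
  induction n with
  | zero =>
    have hid : HasDerivAt (fun ε : ℝ => (1 + ε * I : ℂ)) I 0 := by
      simpa using ((hasDerivAt_id (0 : ℝ)).ofReal_comp.mul_const I).const_add 1
    refine ⟨0, 1, le_rfl, zero_le_one, by simp, ?_⟩
    simpa using (hasDerivAt_const (0 : ℝ) (2 : ℂ)).prodMk hid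
  | succ n ih =>
    obtain ⟨y, z, hy, hyz, hz, hd⟩ := ih
    -- For heights `y, z` of the vertices at abscissas 2 and 1, the linearised pop of 1 sends `y` to
    -- `y' = 4z - y`, and that of 2 sends `z` to `4y' - z`. Since `0 ≤ y ≤ z`, the new `z` is at
    -- least `11z`.
    refine ⟨4 * z - y, 15 * z - 4 * y, by linarith, by linarith, by rw [pow_succ]; linarith, ?_⟩
    have h0 : (popBoth 3)^[n] ((2, 1 + (0 : ℝ) * I) : ℂ × ℂ) = (2, 1) := by
      simpa [flatQuad, vertices] using iterate_flatQuad n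
    simp only [Function.iterate_succ_apply', popBoth, popOne, popTwo]
    have hf : HasDerivAt (fun ε : ℝ => ((popBoth 3)^[n] ((2, 1 + ε * I) : ℂ × ℂ)).1) (I * y) 0 :=
      (ContinuousLinearMap.fst ℝ ℂ ℂ).hasFDerivAt.comp_hasDerivAt _ hd
    have hg : HasDerivAt (fun ε : ℝ => ((popBoth 3)^[n] ((2, 1 + ε * I) : ℂ × ℂ)).2) (I * z) 0 :=
      (ContinuousLinearMap.snd ℝ ℂ ℂ).hasFDerivAt.comp_hasDerivAt _ hd
    have hf0 : ((popBoth 3)^[n] ((2, 1 + (0 : ℝ) * I) : ℂ × ℂ)).1 = 2 := by rw [h0]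
    have hg0 : ((popBoth 3)^[n] ((2, 1 + (0 : ℝ) * I) : ℂ × ℂ)).2 = 1 := by rw [h0]
    set f : ℝ → ℂ := fun ε => ((popBoth 3)^[n] ((2, 1 + ε * I) : ℂ × ℂ)).1
    set g : ℝ → ℂ := fun ε => ((popBoth 3)^[n] ((2, 1 + ε * I) : ℂ × ℂ)).2
    have hf0' : f 0 = 2 := hf0
    have hg0' : g 0 = 1 := hg0
    have h1 : HasDerivAt (fun ε => g ε * conj (f ε) / conj (g ε)) (I * (4 * z - y)) 0 := by
      refine ((hg.mul (hasDerivAt_conj hf)).div (hasDerivAt_conj hg) (by simp [hg0'])).congr_deriv ?_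
      simp [hf0', hg0', conj_ofNat]
      ring
    have h2 := h1.sub_const 3
    have h3 : HasDerivAt (fun ε => 3 + (g ε * conj (f ε) / conj (g ε) - 3) * conj (g ε - 3) /
        conj (g ε * conj (f ε) / conj (g ε) - 3)) (I * (15 * z - 4 * y)) 0 := by
      refine (((h2.mul (hasDerivAt_conj (hg.sub_const 3))).div (hasDerivAt_conj h2) ?_).const_add
        3).congr_deriv ?_
      · simp [hf0', hg0', conj_ofNat]; norm_num
      · simp [hf0', hg0', conj_ofNat]
        ring
    have h4 := h1.prodMk h3
    push_cast
    exact h4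

/-- Lifting vertex 2 off the flat quadrilateral, the displacement of that vertex under `n` double
pops has derivative `I * (z - 1)` with `z ≥ 11 ^ n > 1`, so this rational function is not
identically zero. -/
theorem volume_iterate_eq {n : ℕ} (hn : 0 < n) :
    volume {x : Fin 5 → ℝ | (popBoth (x 0))^[n] (vertices x) = vertices x} = 0 := by
  have h := (isRat_iterate n).2.sub (isRat_iterate 0).2
  refine measure_mono_null (fun x hx => ?_) (h.volume_zeros (x₀ := flatQuad) ?_ ?_)
  · exact sub_eq_zero.2 (congrArg Prod.snd hx)
  · filter_upwards [((contDiffAt_iterate n).2.sub (contDiffAt_iterate 0).2).eventually (by simp)]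
      with x hx using hx.continuousAt
  · obtain ⟨y, z, -, -, hz, hd⟩ := hasDerivAt_iterate n
    have hd2 := (ContinuousLinearMap.snd ℝ ℂ ℂ).hasFDerivAt.comp_hasDerivAt _ hd
    have hid : HasDerivAt (fun ε : ℝ => (1 + ε * I : ℂ)) I 0 := by
      simpa using ((hasDerivAt_id (0 : ℝ)).ofReal_comp.mul_const I).const_add 1
    have hz1 : 1 < z := lt_of_lt_of_le (one_lt_pow₀ (by norm_num) hn.ne') hz
    have hne : I * z - I ≠ 0 := by
      rw [← mul_sub_one]
      refine mul_ne_zero I_ne_zero ?_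
      exact_mod_cast (sub_pos.2 hz1).ne'
    have hev := (hd2.sub hid).eventually_ne hne (c := 0)
    have htend : Tendsto (fun ε : ℝ => (![3, 2, 0, 1, ε] : Fin 5 → ℝ)) (𝓝[≠] 0) (𝓝 flatQuad) := by
      refine tendsto_nhdsWithin_of_tendsto_nhds (Continuous.tendsto' ?_ _ _ rfl)
      refine continuous_pi fun i => ?_
      fin_cases i <;> simp <;> fun_prop
    refine htend.frequently (hev.frequently.mono fun ε hε => ?_)
    simpa [vertices] using hε

/-! ### From quadrilaterals to bar lengths. -/

/-- The distance between the vertices `1` and `3`, followed by the bar lengths. -/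
noncomputable def lengths (x : Fin 5 → ℝ) : Fin 5 → ℝ :=
  ![‖(vertices x).1 - x 0‖, ‖(vertices x).1‖, ‖(vertices x).1 - (vertices x).2‖,
    ‖(vertices x).2 - x 0‖, x 0]

/-- The coordinates of quadrilaterals whose diagonal from `1` to `3` and bars have positive
length. -/
def properCoords : Set (Fin 5 → ℝ) :=
  {x | (vertices x).1 - x 0 ≠ 0 ∧ (vertices x).1 ≠ 0 ∧ (vertices x).1 - (vertices x).2 ≠ 0 ∧
    (vertices x).2 - x 0 ≠ 0}

theorem differentiableOn_lengths : DifferentiableOn ℝ lengths properCoords := by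
  intro x hx
  have hcoord : ∀ i, DifferentiableAt ℝ (fun x : Fin 5 → ℝ => (x i : ℂ)) x := fun i =>
    ofRealCLM.differentiableAt.comp x (differentiableAt_apply i x)
  have h1 : DifferentiableAt ℝ (fun x => (vertices x).1) x :=
    (hcoord 1).add ((hcoord 2).mul_const I)
  have h2 : DifferentiableAt ℝ (fun x => (vertices x).2) x :=
    (hcoord 3).add ((hcoord 4).mul_const I)
  refine (differentiableAt_pi.2 fun i => ?_).differentiableWithinAt
  fin_cases i
  · exact (h1.sub (hcoord 0)).norm ℝ hx.1
  · exact h1.norm ℝ hx.2.1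
  · exact (h1.sub h2).norm ℝ hx.2.2.1
  · exact (h2.sub (hcoord 0)).norm ℝ hx.2.2.2
  · exact differentiableAt_apply 0 x

/-- A null set of quadrilaterals is avoided by some diagonal length, for almost all bar lengths. -/
theorem ae_ae_notMem_image {Z : Set (Fin 5 → ℝ)} (hZ : volume Z = 0) :
    ∀ᵐ l : Fin 4 → ℝ, ∀ᵐ s : ℝ, (Fin.cons s l : Fin 5 → ℝ) ∉ lengths '' (Z ∩ properCoords) := by
  -- The diagonal as fifth length makes source and target of equal dimension, so differentiability
  -- suffices to preserve null sets.
  have h1 : volume (lengths '' (Z ∩ properCoords)) = 0 :=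
    addHaar_image_eq_zero_of_differentiableOn_of_addHaar_eq_zero _
      (differentiableOn_lengths.mono Set.inter_subset_right) (measure_mono_null Set.inter_subset_left hZ)
  have h2 := ((volume_preserving_piFinSuccAbove (fun _ : Fin 5 => ℝ) 0).symm).comp
    (Measure.measurePreserving_swap (μ := (volume : Measure (Fin 4 → ℝ))) (ν := (volume : Measure ℝ)))
  have h3 := h2.quasiMeasurePreserving.ae (measure_eq_zero_iff_ae_notMem.1 h1)
  have h4 := Measure.ae_ae_of_ae_prod h3
  filter_upwards [h4] with l hl
  filter_upwards [hl] with s hs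
  simpa [MeasurableEquiv.piFinSuccAbove] using! hs

/-- Every quadrilateral linkage has configurations for an interval of lengths of the diagonal. -/
theorem exists_coords {l : Fin 4 → ℝ} (hl : IsLinkage l) {s : ℝ}
    (hs : s ∈ Set.Ioo (max |l 0 - l 3| |l 1 - l 2|) (min (l 0 + l 3) (l 1 + l 2))) :
    ∃ x ∈ properCoords, x 0 = l 3 ∧ vertices x ∈ curve l ∧ lengths x = Fin.cons s l := by
  obtain ⟨hs1, hs2⟩ := hs
  rw [max_lt_iff] at hs1
  rw [lt_min_iff] at hs2
  have hs0 : 0 < s := (abs_nonneg _).trans_lt hs1.1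
  have hpos := hl.pos
  have sq1 : (l 0 - l 3) ^ 2 ≤ s ^ 2 := sq_le_sq' (by linarith [(abs_lt.1 hs1.1).1]) (abs_lt.1 hs1.1).2.le
  have sq2 : (l 1 - l 2) ^ 2 ≤ s ^ 2 := sq_le_sq' (by linarith [(abs_lt.1 hs1.2).1]) (abs_lt.1 hs1.2).2.le
  have sq3 : s ^ 2 ≤ (l 0 + l 3) ^ 2 := pow_le_pow_left₀ hs0.le hs2.1.le 2
  have sq4 : s ^ 2 ≤ (l 1 + l 2) ^ 2 := pow_le_pow_left₀ hs0.le hs2.2.le 2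
  have hL : (l 3 : ℂ) ≠ 0 := by exact_mod_cast (hpos 3).ne'
  -- Build the triangle 0, 3, 1 with diagonal `s`, then erect the triangle 3, 1, 2 on that diagonal.
  obtain ⟨hv1, hv2⟩ := norm_third (s := 1) (r := l 0) (m := s) hL (by norm_num) (hpos 0).le hs0.le (by
    rw [normSq_ofReal]
    have : heron (l 0) s (l 3 * l 3) = ((l 0 + l 3) ^ 2 - s ^ 2) * (s ^ 2 - (l 0 - l 3) ^ 2) := by
      unfold heron; ring
    rw [this]
    exact mul_nonneg (by linarith) (by linarith))
  set v := third 1 (l 0) s (l 3 : ℂ)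
  rw [norm_sub_rev] at hv2
  have hv0 : v - l 3 ≠ 0 := norm_pos_iff.1 (hv2 ▸ hs0)
  obtain ⟨hw1, hw2⟩ := norm_third (s := 1) (r := l 2) (m := l 1) hv0 (by norm_num) (hpos 2).le
    (hpos 1).le (by
      rw [heron_eq, normSq_eq_norm_sq, hv2]
      exact mul_nonneg (by linarith) (by linarith))
  set w := third 1 (l 2) (l 1) (v - l 3)
  have hver : vertices ![l 3, v.re, v.im, (l 3 + w).re, (l 3 + w).im] = (v, l 3 + w) := by
    refine Prod.ext ?_ ?_
    · exact re_add_im v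
    · exact re_add_im (l 3 + w)
  have hmem : (v, l 3 + w) ∈ curve l :=
    ⟨hv1, by rw [← sub_sub, hw2], by rw [add_sub_cancel_left, hw1]⟩
  refine ⟨![l 3, v.re, v.im, (l 3 + w).re, (l 3 + w).im], ?_, rfl, hver ▸ hmem, ?_⟩
  · rw [properCoords, Set.mem_ofPred_eq, hver]
    exact ⟨hv0, fst_ne_zero hl hmem, norm_pos_iff.1 (hmem.2.1 ▸ hpos 1),
      sub_ne_zero.2 (snd_ne_ground hl hmem)⟩
  · rw [lengths, hver]
    ext i
    fin_cases i
    · exact hv2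
    · exact hmem.1
    · exact hmem.2.1
    · exact hmem.2.2
    · rfl

/-- For almost all linkages, alternate pops never return to some configuration. -/
theorem ae_exists_iterate_ne : ∀ᵐ l : Fin 4 → ℝ, IsLinkage l →
    ∃ p ∈ curve l, ∀ n : ℕ, 0 < n → (popBoth (l 3))^[n] p ≠ p := by
  have hZ : volume (⋃ n : ℕ, {x : Fin 5 → ℝ | (popBoth (x 0))^[n + 1] (vertices x) = vertices x}) = 0 :=
    measure_iUnion_null fun n => volume_iterate_eq n.succ_pos
  filter_upwards [ae_ae_notMem_image hZ] with l hae hl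
  have e1 := hl.lower₁
  have e2 := hl.lower₂
  have e3 := hl.lower₃
  have e4 := hl.upper
  have hlt : max |l 0 - l 3| |l 1 - l 2| < min (l 0 + l 3) (l 1 + l 2) := by
    have p0 := hl.pos 0
    have p1 := hl.pos 1
    have p2 := hl.pos 2
    have p3 := hl.pos 3
    simp only [max_lt_iff, lt_min_iff, abs_lt]
    refine ⟨⟨⟨?_, ?_⟩, ?_, ?_⟩, ⟨?_, ?_⟩, ?_, ?_⟩ <;> linarith
  -- A set of full measure is dense, so it meets the nonempty open interval of realisable diagonals.
  obtain ⟨s, hs, hsZ⟩ := (Measure.dense_of_ae hae).exists_mem_open isOpen_Ioo (Set.nonempty_Ioo.2 hlt)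
  obtain ⟨x, hx, hx0, hxc, hxl⟩ := exists_coords hl hsZ
  refine ⟨vertices x, hxc, fun n hn h => hs ?_⟩
  refine ⟨x, ⟨Set.mem_iUnion.2 ⟨n - 1, ?_⟩, hx⟩, hxl⟩
  rw [Set.mem_ofPred_eq, Nat.sub_add_cancel hn, hx0, h]

end FourBar

theorem corollary1 :
    ∀ᵐ l : Fin 4 → ℝ ∂volume,
      FourBar.IsLinkage l →
      FourBar.T₁ l * FourBar.T₂ l * FourBar.T₃ l < 0 →
      (max (l 1) (l 3) ≤ min (l 0) (l 2) ∨ max (l 0) (l 2) ≤ min (l 1) (l 3)) →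
      ∃ k : Fin 4, ∀ C₀ C' : FourBar.Quad,
        FourBar.SmoothlyReachable l C₀ C' → FourBar.CanReachNeighborhood l k C' := by
  filter_upwards [FourBar.ae_exists_iterate_ne] with l hae hl hT _
  obtain ⟨p, hp, hne⟩ := hae hl
  -- The popped vertices are 1 and 2, the two off the ground link.
  refine ⟨1, fun C₀ C' ⟨γ, _, hγ, _, hγ1⟩ => ?_⟩
  exact FourBar.canReachNeighborhood_of_iterate_ne hl hT hp hne
    (hγ1 ▸ hγ 1 (Set.right_mem_Icc.2 zero_le_one))
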